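/- **Setting.** Let $\Sigma$ be a smooth (Hausdorff, second countable, boundaryless) three-manifold. A *Cauchy pair* $(\mathfrak e,\Theta)$ on $\Sigma$ consists of a smooth global coframe $\mathfrak e=(e_u,e_l,e_n)$ and a smooth symmetric covariant two-tensor $\Theta$. Let $(e_u^\sharp,e_l^\sharp,e_n^\sharp)$ be the dual frame, $h_{\mathfrak e}=e_u\otimes e_u+e_l\otimes e_l+e_n\otimes e_n$, and $\Theta(e_i)=\Theta(e_i^\sharp,\cdot)$. The pair is *parallel* if $$\mathrm d e_i=\Theta(e_i)\wedge e_u\quad (i=u,l,n),\qquad [\Theta(e_u)]=0\in H^1_{dR}(\Sigma),$$ the latter meaning that $\Theta(e_u)$ is exact. It is *fully complete* if the Riemannian manifold $(\Sigma,h_{\mathfrak e})$ is complete and, writing $\Theta(e_u)=-\mathrm d\mathfrak f$ and $\hat e_u=e^{\mathfrak f}e_u$, the vector field $\hat e_u^\sharp=e^{-\mathfrak f}e_u^\sharp$ (the dual of $\hat e_u$ with respect to the coframe $(\hat e_u,e_l,e_n)$) is complete. We say that $(\mathfrak e,\Theta)$ is *in normal form* with respect to global coordinates $(x,y,z)$ (a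 diffeomorphism $\Sigma\cong\mathbb R^3$), $\mathfrak u\in C^\infty(\mathbb R^3)$ and $\mathfrak F\in C^\infty(\mathbb R)$ if $$\mathfrak e=(e^{\mathfrak u}\mathrm dx,\;e_l(x),\;e_n(x)),\qquad (\mathcal L_x e_l)(e_n^\sharp)=(\mathcal L_x e_n)(e_l^\sharp),$$ where $e_l(x)$ and $e_n(x)$ are smooth $x$-dependent families of closed one-forms on the planes $\{x\}\times\mathbb R^2$ (no $\mathrm dx$-component, and closed when restricted to each plane), $\mathcal L_x$ is the Lie derivative along $\partial_x$, and, with the resulting family of flat metrics $h_x=e_l(x)\otimes e_l(x)+e_n(x)\otimes e_n(x)$, $$\Theta=\big(\mathfrak F(x)e^{-\mathfrak u}+\partial_x e^{-\mathfrak u}\big)\,e_u\otimes e_u+e_u\otimes \mathrm d\mathfrak u+\mathrm d\mathfrak u\otimes e_u-\tfrac12 e^{-\mathfrak u}\mathcal L_x h_x .$$ **Theorem.** Let $\Sigma$ be connected and simply connected, and let $(\mathfrak e,\Theta)$ be a Cauchy pair on $\Sigma$. 1. $(\mathfrak e,\Theta)$ is parallel and fully complete if and only if there exist global coordinates $(x,y,z)$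 identifying $\Sigma=\mathbb R^3$ and smooth functions $\mathfrak u\in C^\infty(\mathbb R^3)$, $\mathfrak F\in C^\infty(\mathbb R)$ for which $(\mathfrak e,\Theta)$ is in normal form, $h_{\mathfrak e}$ is complete, and the vector field $\exp\!\big(\int_0^x\mathfrak F(s)\,\mathrm ds\big)\partial_x$ on $\mathbb R$ is complete. 2. Whenever $(\mathfrak e,\Theta)$ is in normal form for some global coordinates, some $\mathfrak u\in C^\infty(\mathbb R^3)$ and an arbitrary $\mathfrak F\in C^\infty(\mathbb R)$ (no completeness assumed), it is parallel. -/

import Mathlib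

open scoped Manifold ContDiff Topology ENNReal
open Bundle

noncomputable section

namespace CauchyPair

/-- The Cartesian space `ℝ³`, with coordinates `(x, y, z) = (q 0, q 1, q 2)`. -/
abbrev R3 : Type := EuclideanSpace ℝ (Fin 3)

section Manifold

variable {M : Type*} [TopologicalSpace M] [ChartedSpace R3 M]

/-- A (not necessarily smooth) one-form on a three-manifold. -/
abbrev OneForm (M : Type*) [TopologicalSpace M] [ChartedSpace R3 M] : Type _ :=
  (p : M) → TangentSpace (𝓡 3) p →L[ℝ] ℝ

/-- A (not necessarily smooth) covariant two-tensor on a three-manifold. -/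
abbrev TwoTensor (M : Type*) [TopologicalSpace M] [ChartedSpace R3 M] : Type _ :=
  (p : M) → TangentSpace (𝓡 3) p →L[ℝ] TangentSpace (𝓡 3) p →L[ℝ] ℝ

/-- Smoothness of a one-form, as a section of the cotangent bundle. -/
def OneForm.Smooth [IsManifold (𝓡 3) ∞ M] (η : OneForm M) : Prop :=
  ContMDiff (𝓡 3) ((𝓡 3).prod 𝓘(ℝ, R3 →L[ℝ] ℝ)) ∞
    (fun p ↦ TotalSpace.mk' (R3 →L[ℝ] ℝ)
      (E := fun p : M ↦ TangentSpace (𝓡 3) p →L[ℝ] Trivial M ℝ p) p (η p))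

/-- Smoothness of a two-tensor, as a section of the bundle `T*M ⊗ T*M`. -/
def TwoTensor.Smooth [IsManifold (𝓡 3) ∞ M] (T : TwoTensor M) : Prop :=
  ContMDiff (𝓡 3) ((𝓡 3).prod 𝓘(ℝ, R3 →L[ℝ] R3 →L[ℝ] ℝ)) ∞
    (fun p ↦ TotalSpace.mk' (R3 →L[ℝ] R3 →L[ℝ] ℝ)
      (E := fun p : M ↦ TangentSpace (𝓡 3) p →L[ℝ] TangentSpace (𝓡 3) p →L[ℝ] Trivial M ℝ p)
      p (T p))

/-- The pullback of a one-form along the inverse of the preferred chart at `p`. -/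
def OneForm.inChart (η : OneForm M) (p : M) (y : R3) : R3 →L[ℝ] ℝ :=
  (η ((extChartAt (𝓡 3) p).symm y)).comp
    (mfderiv 𝓘(ℝ, R3) (𝓡 3) (extChartAt (𝓡 3) p).symm y)

/-- The exterior derivative `(dη)_p(v, w)`: the exterior derivative in `ℝ³` of the local expression
of `η` in the chart at `p`, pulled back to `p` along the chart. The normalization is
`dη(X, Y) = X(η(Y)) - Y(η(X)) - η([X, Y])`. -/
def OneForm.d (η : OneForm M) (p : M) (v w : TangentSpace (𝓡 3) p) : ℝ :=
  extDeriv
    (fun y ↦ ContinuousAlternatingMap.ofSubsingleton ℝ R3 ℝ (0 : Fin 1) (η.inChart p y))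
    (extChartAt (𝓡 3) p p)
    ![mfderiv (𝓡 3) 𝓘(ℝ, R3) (extChartAt (𝓡 3) p) p v,
      mfderiv (𝓡 3) 𝓘(ℝ, R3) (extChartAt (𝓡 3) p) p w]

/-- A smooth coframe `(e_u, e_l, e_n) = (form 0, form 1, form 2)` on a three-manifold: three smooth
one-forms which give at every point an isomorphism of the tangent space with `ℝ³`. -/
structure Coframe (M : Type*) [TopologicalSpace M] [ChartedSpace R3 M]
    [IsManifold (𝓡 3) ∞ M] where
  form : Fin 3 → OneForm M
  smooth : ∀ i, (form i).Smooth
  bijective : ∀ p, Function.Bijective (fun (v : TangentSpace (𝓡 3) p) (i : Fin 3) ↦ form i p v)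

/-- A shape operator: a smooth symmetric covariant two-tensor. -/
structure ShapeOperator (M : Type*) [TopologicalSpace M] [ChartedSpace R3 M]
    [IsManifold (𝓡 3) ∞ M] where
  tensor : TwoTensor M
  smooth : tensor.Smooth
  symm : ∀ p (v w : TangentSpace (𝓡 3) p), tensor p v w = tensor p w v

/-- A vector field is complete if through every point there is an integral curve defined on all
of `ℝ`. -/
def IsCompleteField {E H N : Type*} [NormedAddCommGroup E] [NormedSpace ℝ E] [TopologicalSpace H]
    (I : ModelWithCorners ℝ E H) [TopologicalSpace N] [ChartedSpace H N]
    (X : (p : N) → TangentSpace I p) : Prop :=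
  ∀ p, ∃ γ : ℝ → N, γ 0 = p ∧ IsMIntegralCurve (I := I) γ X

variable [IsManifold (𝓡 3) ∞ M]

namespace Coframe

/-- The dual frame `(e_u^♯, e_l^♯, e_n^♯)`, i.e. `e_i(e_j^♯) = δ_ij`. It is also the metric dual of
the coframe with respect to `h_e = e_u ⊗ e_u + e_l ⊗ e_l + e_n ⊗ e_n`. -/
def sharp (e : Coframe M) (i : Fin 3) (p : M) : TangentSpace (𝓡 3) p :=
  Function.surjInv (e.bijective p).surjective (Pi.single i 1)

theorem form_sharp (e : Coframe M) (i j : Fin 3) (p : M) :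
    e.form i p (e.sharp j p) = if i = j then 1 else 0 := by
  have h := congrFun (Function.surjInv_eq (e.bijective p).surjective
    (Pi.single j (1 : ℝ) : Fin 3 → ℝ)) i
  simpa [Pi.single_apply, sharp] using h

/-- The Riemannian metric `h_e = e_u ⊗ e_u + e_l ⊗ e_l + e_n ⊗ e_n`. -/
def metric (e : Coframe M) (p : M) (v w : TangentSpace (𝓡 3) p) : ℝ :=
  ∑ i, e.form i p v * e.form i p w

/-- The Riemannian distance of `h_e`: the infimum of the `h_e`-lengths of `C¹` paths. -/
def dist (e : Coframe M) (p q : M) : ℝ≥0∞ :=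
  letI : ∀ x : M, ENorm (TangentSpace (𝓡 3) x) :=
    fun x ↦ ⟨fun v ↦ ENNReal.ofReal (Real.sqrt (e.metric x v v))⟩
  Manifold.riemannianEDist (𝓡 3) p q

/-- Completeness of the Riemannian manifold `(M, h_e)`: Cauchy sequences for the Riemannian
distance converge. -/
def IsComplete (e : Coframe M) : Prop :=
  ∀ s : ℕ → M,
    (∀ ε : ℝ≥0∞, 0 < ε → ∃ N, ∀ m ≥ N, ∀ n ≥ N, e.dist (s m) (s n) < ε) →
    ∃ p, Filter.Tendsto (fun n ↦ e.dist (s n) p) Filter.atTop (𝓝 0)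

/-- The coframe `(exp(f) e_u, e_l, e_n)`. -/
def rescale (e : Coframe M) (f : M → ℝ) (hf : ContMDiff (𝓡 3) 𝓘(ℝ, ℝ) ∞ f) : Coframe M where
  form i p := (if i = 0 then Real.exp (f p) else 1) • e.form i p
  smooth i := by
    have hg : ContMDiff (𝓡 3) 𝓘(ℝ, ℝ) ∞ (fun p ↦ if i = 0 then Real.exp (f p) else 1) := by
      by_cases hi : i = 0
      · simp only [hi, if_true]
        exact Real.contDiff_exp.comp_contMDiff hf
      · simp only [hi, if_false]
        exact contMDiff_const
    exact hg.smul_section (e.smooth i)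
  bijective p := by
    have hpos : ∀ i : Fin 3, (if i = 0 then Real.exp (f p) else 1) ≠ 0 := by
      intro i
      split_ifs
      · exact Real.exp_ne_zero _
      · exact one_ne_zero
    constructor
    · intro v w h
      apply (e.bijective p).injective
      funext i
      have h' := congrFun h i
      simp only [smul_apply, smul_eq_mul] at h'
      exact mul_left_cancel₀ (hpos i) h'
    · intro y
      obtain ⟨v, hv⟩ := (e.bijective p).surjective
        (fun i ↦ (if i = 0 then Real.exp (f p) else 1)⁻¹ * y i)
      refine ⟨v, funext fun i ↦ ?_⟩
      have h' := congrFun hv i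
      simp only [smul_apply, smul_eq_mul] at h' ⊢
      rw [h', mul_inv_cancel_left₀ (hpos i)]

end Coframe

/-- The one-form `Θ(e_i)`, where `Θ` acts on one-forms through the metric `h_e`. -/
def thetaForm (e : Coframe M) (Θ : ShapeOperator M) (i : Fin 3) : OneForm M :=
  fun p ↦ Θ.tensor p (e.sharp i p)

/-- `f` is a smooth function with `Θ(e_u) = -df`. -/
def IsPotential (e : Coframe M) (Θ : ShapeOperator M) (f : M → ℝ) : Prop :=
  ContMDiff (𝓡 3) 𝓘(ℝ, ℝ) ∞ f ∧
    ∀ p (v : TangentSpace (𝓡 3) p), thetaForm e Θ 0 p v = -(mfderiv (𝓡 3) 𝓘(ℝ, ℝ) f p v : ℝ)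

/-- The parallel Cauchy differential system: `d e_i = Θ(e_i) ∧ e_u` for `i = u, l, n`, and
`[Θ(e_u)] = 0` in de Rham cohomology, i.e. `Θ(e_u)` is exact. -/
def IsParallel (e : Coframe M) (Θ : ShapeOperator M) : Prop :=
  (∀ (i : Fin 3) (p : M) (v w : TangentSpace (𝓡 3) p),
      (e.form i).d p v w
        = thetaForm e Θ i p v * e.form 0 p w - thetaForm e Θ i p w * e.form 0 p v) ∧
    ∃ f : M → ℝ, IsPotential e Θ f

/-- The pair is fully complete: `h_e` is complete and, with `Θ(e_u) = -df` and
`ê = (exp(f) e_u, e_l, e_n)`, the vector field `ê_u^♯` is complete. (On a connected manifold `f` is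
unique up to a constant, so that the choice of `f` is immaterial.) -/
def IsFullyComplete (e : Coframe M) (Θ : ShapeOperator M) : Prop :=
  e.IsComplete ∧
    ∃ (f : M → ℝ) (hf : IsPotential e Θ f),
      IsCompleteField (𝓡 3) ((e.rescale f hf.1).sharp 0)

end Manifold

section Coordinates

/-- The coordinate vector field `∂_x` on `ℝ³`. -/
def ex : R3 := EuclideanSpace.single 0 1

/-- The Lie derivative `(L_x η)(v)` of a one-form on `ℝ³` along the coordinate field `∂_x`: since
`∂_x` is constant, it differentiates the coefficients of `η`. -/
def lieX (η : OneForm R3) (q v : R3) : ℝ := fderiv ℝ (fun q' ↦ (η q' v : ℝ)) q ex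

/-- The Lie derivative `(L_x h_x)(v, w)` of `h_x = e_l ⊗ e_l + e_n ⊗ e_n` along `∂_x`. -/
def lieXMetric (ε : Coframe R3) (q v w : R3) : ℝ :=
  fderiv ℝ (fun q' ↦ (ε.form 1 q' v * ε.form 1 q' w + ε.form 2 q' v * ε.form 2 q' w : ℝ)) q ex

/-- `η = η(x)` is a family, parametrized by `x`, of closed one-forms on the planes `{x} × ℝ²`:
it has no `dx`-component and it restricts to a closed form on every plane `x = const`. -/
def IsClosedSliceFamily (η : OneForm R3) : Prop :=
  (∀ q, η q ex = 0) ∧ ∀ q (v w : R3), v 0 = 0 → w 0 = 0 → η.d q v w = 0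

/-- The coframe `ε` on `ℝ³` has the form `(exp(u) dx, e_l(x), e_n(x))`, with
`(L_x e_l)(e_n^♯) = (L_x e_n)(e_l^♯)`. -/
def IsNormalCoframe (ε : Coframe R3) (u : R3 → ℝ) : Prop :=
  (∀ q v : R3, ε.form 0 q v = Real.exp (u q) * v 0) ∧
    IsClosedSliceFamily (ε.form 1) ∧ IsClosedSliceFamily (ε.form 2) ∧
    ∀ q, lieX (ε.form 1) q (ε.sharp 2 q) = lieX (ε.form 2) q (ε.sharp 1 q)

/-- The two-tensor
`(F(x) exp(-u) + ∂_x exp(-u)) e_u ⊗ e_u + e_u ⊗ du + du ⊗ e_u - (1/2) exp(-u) L_x h_x` on `ℝ³`. -/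
def normalTheta (ε : Coframe R3) (u : R3 → ℝ) (F : ℝ → ℝ) (q v w : R3) : ℝ :=
  (F (q 0) * Real.exp (-u q) + fderiv ℝ (fun q' ↦ Real.exp (-u q')) q ex)
      * (ε.form 0 q v * ε.form 0 q w)
    + ε.form 0 q v * fderiv ℝ u q w + fderiv ℝ u q v * ε.form 0 q w
    - 1 / 2 * Real.exp (-u q) * lieXMetric ε q v w

/-- In the global coordinates `φ : M → ℝ³` the pair `(e, Θ)` is given by the normal coframe `ε` with
function `u` and by the two-tensor `normalTheta ε u F`. -/
structure HasNormalForm {M : Type*} [TopologicalSpace M] [ChartedSpace R3 M]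
    [IsManifold (𝓡 3) ∞ M] (e : Coframe M) (Θ : ShapeOperator M)
    (φ : M ≃ₘ^∞⟮𝓡 3, 𝓡 3⟯ R3) (ε : Coframe R3) (u : R3 → ℝ) (F : ℝ → ℝ) : Prop where
  contDiff_u : ContDiff ℝ ∞ u
  contDiff_F : ContDiff ℝ ∞ F
  coframe : ∀ (i : Fin 3) (p : M) (v : TangentSpace (𝓡 3) p),
    e.form i p v = ε.form i (φ p) (mfderiv (𝓡 3) (𝓡 3) φ p v)
  normal : IsNormalCoframe ε u
  theta : ∀ (p : M) (v w : TangentSpace (𝓡 3) p),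
    Θ.tensor p v w
      = normalTheta ε u F (φ p) (mfderiv (𝓡 3) (𝓡 3) φ p v) (mfderiv (𝓡 3) (𝓡 3) φ p w)

/-- The vector field `exp(∫₀ˣ F) ∂_x` on the real line. -/
def lineField (F : ℝ → ℝ) (x : ℝ) : TangentSpace 𝓘(ℝ, ℝ) x :=
  (Real.exp (∫ s in (0 : ℝ)..x, F s) : ℝ)

end Coordinates

end CauchyPair

end

/-! Let `f` be a potential, Θ(e_u) = -df. The equation for e_u says exactly that exp(f) e_u is
closed, so on a simply connected Σ it equals dx for a global function x. The dual field ê_u♯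
satisfies dx(ê_u♯) = 1 and is complete, so its flow moves the level sets of x onto one another and
yields a smooth retraction r of Σ onto the slice x = 0. As de_i = Θ(e_i) ∧ e_u and e_u vanishes on
the image of dr, the forms r^*e_l and r^*e_n are closed; their primitives y and z are constant along
ê_u♯. Completeness of h_e makes the unit fields e_l♯ and e_n♯ complete, because their integral
curves are 1-Lipschitz for the Riemannian distance. Flowing from a point of the slice along e_n♯,
then e_l♯, then ê_u♯ gives a smooth map ℝ³ → Σ with left inverse (x, y, z), up to constants. Its
range is open (inverse function argument) and closed (a fixed-point set), hence all of Σ.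

In these coordinates e_u = exp(u) dx with u = -f, and e_l, e_n annihilate ∂_x. The rest is linear
algebra: Cartan's formula turns the (∂_x, ·) part of the system into L_x e_i = -exp(u) Θ(e_i♯, ·) on
slices. Symmetry of Θ becomes the symmetry condition on e_l and e_n, and Θ is recovered as
`normalTheta` with F = 0 (`IsAdapted.isNormalCoframe`).

Conversely, a normal form gives Θ(e_u) = F dx + du, with potential -(u + ∫F). The structure
equations follow from the same algebra without completeness (`IsNormalCoframe.d_eq`). The rescaled
dual field is exp(∫F) ∂_x, whose completeness is that of the field on the line.

The analytic inputs are smooth flows (`contMDiff_integralFlow`), primitives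
(`OneForm.LocallyExact.exists_primitive`) and completeness of frame fields
(`Coframe.IsComplete.isCompleteField_sharp`). -/

noncomputable section

/-! ### Superposition operators on spaces of continuous functions -/

namespace ContinuousMap

variable {K : Type*} [TopologicalSpace K] [CompactSpace K]

section Superposition

variable {E F : Type*} [NormedAddCommGroup E] [NormedSpace ℝ E]
  [NormedAddCommGroup F] [NormedSpace ℝ F]

set_option synthInstance.maxHeartbeats 200000 in
/-- Pointwise evaluation of a family of operators on a family of vectors, as a continuous bilinear
map between spaces of continuous functions. -/
def pointwiseApplyL (K : Type*) [TopologicalSpace K] [CompactSpace K] (E F : Type*)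
    [NormedAddCommGroup E] [NormedSpace ℝ E] [NormedAddCommGroup F] [NormedSpace ℝ F] :
    C(K, E →L[ℝ] F) →L[ℝ] C(K, E) →L[ℝ] C(K, F) :=
  LinearMap.mkContinuous₂
    (LinearMap.mk₂ ℝ (fun (A : C(K, E →L[ℝ] F)) (h : C(K, E)) ↦
        (⟨fun t ↦ A t (h t), A.continuous.clm_apply h.continuous⟩ : C(K, F)))
      (fun A B h ↦ by ext t; simp) (fun c A h ↦ by ext t; simp)
      (fun A h k ↦ by ext t; simp) (fun c A h ↦ by ext t; simp)) 1
    (fun A h ↦ by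
      rw [one_mul, ContinuousMap.norm_le _ (by positivity)]
      intro t
      exact (A t).le_of_opNorm_le_of_le (A.norm_coe_le_norm t) (h.norm_coe_le_norm t))

@[simp]
theorem pointwiseApplyL_apply (A : C(K, E →L[ℝ] F)) (h : C(K, E)) (t : K) :
    pointwiseApplyL K E F A h t = A t (h t) := rfl

/-- Postcomposition with `g` is continuous for the sup norm, which gives one δ for all points of the
compact space. -/
theorem exists_norm_sub_le_of_dist_lt {E F : Type*} [NormedAddCommGroup E] [NormedAddCommGroup F]
    (g : C(E, F)) (α : C(K, E)) {c : ℝ} (hc : 0 < c) :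
    ∃ δ > 0, ∀ β : C(K, E), dist β α < δ → ∀ t, ‖g (β t) - g (α t)‖ ≤ c := by
  obtain ⟨δ, hδ, h1⟩ := Metric.continuous_iff.mp
    (g.continuous_postcomp : Continuous fun β : C(K, E) ↦ g.comp β) α c hc
  refine ⟨δ, hδ, fun β hβ t ↦ ?_⟩
  have h2 := h1 β hβ
  rw [dist_eq_norm] at h2
  exact ((g.comp β - g.comp α).norm_coe_le_norm t).trans h2.le

-- The mean value inequality is applied at each `t` on the segment from `α t` to `β t`. The modulus
-- of continuity of `f'` along `α` is uniform in `t`, so the pointwise remainder bounds give a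
-- sup-norm bound.
set_option synthInstance.maxHeartbeats 200000 in
theorem hasFDerivAt_postcomp (f : C(E, F)) (f' : C(E, E →L[ℝ] F))
    (hf : ∀ x, HasFDerivAt f (f' x) x) (α : C(K, E)) :
    HasFDerivAt (fun β : C(K, E) ↦ f.comp β) (pointwiseApplyL K E F (f'.comp α)) α := by
  rw [hasFDerivAt_iff_isLittleO, Asymptotics.isLittleO_iff]
  intro c hc
  obtain ⟨δ, hδ, h1⟩ := exists_norm_sub_le_of_dist_lt f' α hc
  filter_upwards [Metric.ball_mem_nhds α hδ] with β hβ
  rw [ContinuousMap.norm_le _ (by positivity)]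
  intro t
  have hbound : ∀ x ∈ segment ℝ (α t) (β t), ‖f' x - f' (α t)‖ ≤ c := by
    intro x hx
    rw [segment_eq_image'] at hx
    obtain ⟨s, hs, rfl⟩ := hx
    have hd : dist (α + s • (β - α)) α < δ := by
      rw [dist_eq_norm, add_sub_cancel_left, norm_smul, Real.norm_of_nonneg hs.1]
      calc s * ‖β - α‖ ≤ 1 * ‖β - α‖ := by gcongr; exact hs.2
        _ = dist β α := by rw [one_mul, dist_eq_norm]
        _ < δ := hβ
    exact h1 _ hd t
  have h3 := (convex_segment (𝕜 := ℝ) (α t) (β t)).norm_image_sub_le_of_norm_hasFDerivWithin_le'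
    (fun x _ ↦ (hf x).hasFDerivWithinAt) hbound (left_mem_segment ℝ _ _) (right_mem_segment ℝ _ _)
  calc _ = ‖f (β t) - f (α t) - f' (α t) (β t - α t)‖ := by simp
    _ ≤ c * ‖β t - α t‖ := h3
    _ ≤ c * ‖β - α‖ := by
      gcongr
      exact (β - α).norm_coe_le_norm t

end Superposition

universe u in
set_option synthInstance.maxHeartbeats 200000 in
/-- The superposition operator `β ↦ f ∘ β` on continuous functions on a compact space is as
differentiable as `f`. -/
theorem contDiff_postcomp {E : Type u} [NormedAddCommGroup E] [NormedSpace ℝ E] (n : ℕ) :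
    ∀ {F : Type u} [NormedAddCommGroup F] [NormedSpace ℝ F] (f : C(E, F)),
      ContDiff ℝ n f → ContDiff ℝ n (fun β : C(K, E) ↦ f.comp β) := by
  induction n with
  | zero =>
    intro F _ _ f _
    exact contDiff_zero.mpr f.continuous_postcomp
  | succ n ih =>
    intro F _ _ f hf
    obtain ⟨f', hf', hd⟩ := contDiff_succ_iff_hasFDerivAt.mp (by exact_mod_cast hf)
    push_cast
    refine contDiff_succ_iff_hasFDerivAt.mpr
      ⟨fun α ↦ pointwiseApplyL K E F ((⟨f', hf'.continuous⟩ : C(E, E →L[ℝ] F)).comp α), ?_,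
        fun α ↦ hasFDerivAt_postcomp f ⟨f', hf'.continuous⟩ hd α⟩
    -- The derivative is again a superposition operator, by `f'`, followed by a continuous linear
    -- map. The induction thus changes the codomain from `F` to `E →L[ℝ] F`, which is why both
    -- spaces live in one universe.
    exact (pointwiseApplyL K E F).contDiff.comp (ih ⟨f', hf'.continuous⟩ hf')

end ContinuousMap

/-! ### Smooth dependence of local flows on initial data, by the implicit function theorem -/

section Flow

open Set unitInterval

variable {E : Type*} [NormedAddCommGroup E] [NormedSpace ℝ E] [CompleteSpace E]

/-- The operator `β ↦ (t ↦ ∫₀ᵗ β)` on continuous functions on the unit interval. -/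
def primitiveL (E : Type*) [NormedAddCommGroup E] [NormedSpace ℝ E] [CompleteSpace E] :
    C(I, E) →L[ℝ] C(I, E) :=
  LinearMap.mkContinuous
    { toFun := fun β ↦ ⟨fun t ↦ ∫ τ in (0 : ℝ)..t, β (projIcc 0 1 zero_le_one τ), by
        have hc : Continuous fun τ : ℝ ↦ β (projIcc 0 1 zero_le_one τ) :=
          β.continuous.comp continuous_projIcc
        exact (intervalIntegral.continuous_primitive
          (fun a b ↦ hc.intervalIntegrable a b) 0).comp continuous_subtype_val⟩
      map_add' := fun β γ ↦ by
        ext t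
        have hc (β : C(I, E)) : Continuous fun τ : ℝ ↦ β (projIcc 0 1 zero_le_one τ) :=
          β.continuous.comp continuous_projIcc
        exact intervalIntegral.integral_add ((hc β).intervalIntegrable _ _)
          ((hc γ).intervalIntegrable _ _)
      map_smul' := fun c β ↦ by
        ext t
        exact intervalIntegral.integral_smul _ _ } 1
    (fun β ↦ by
      rw [one_mul, ContinuousMap.norm_le _ (by positivity)]
      intro t
      have h := intervalIntegral.norm_integral_le_of_norm_le_const (a := (0 : ℝ)) (b := t)
        (f := fun τ ↦ β (projIcc 0 1 zero_le_one τ)) (C := ‖β‖)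
        (fun τ _ ↦ β.norm_coe_le_norm _)
      refine h.trans ?_
      rw [sub_zero, abs_of_nonneg t.2.1]
      exact mul_le_of_le_one_right (norm_nonneg _) t.2.2)

theorem primitiveL_apply (β : C(I, E)) (t : I) :
    primitiveL E β t = ∫ τ in (0 : ℝ)..t, β (projIcc 0 1 zero_le_one τ) := rfl

/-- A globally `C^n` vector field has a local flow that is jointly `C^n` in time and initial
point. -/
theorem ContDiff.exists_local_flow {n : ℕ} (hn : 1 ≤ n) {f : E → E} (hf : ContDiff ℝ n f)
    (x₀ : E) :
    ∃ α : E × ℝ → E, (∀ᶠ z in 𝓝 (x₀, (0 : ℝ)), ContDiffAt ℝ n α z) ∧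
      (∀ᶠ x in 𝓝 x₀, α (x, 0) = x) ∧
      ∀ᶠ z in 𝓝 (x₀, (0 : ℝ)), HasDerivAt (fun t ↦ α (z.1, t)) (f (α z)) z.2 := by
  have hn1 : (1 : WithTop ℕ∞) ≤ n := by exact_mod_cast hn
  have hn0 : (n : WithTop ℕ∞) ≠ 0 := by
    intro h; rw [h] at hn1; exact absurd hn1 (by simp)
  obtain ⟨ε, hε, a, r, L, K, hr, hpl⟩ :=
    IsPicardLindelof.of_contDiffAt_one ((hf.of_le hn1).contDiffAt (x := x₀))
  obtain ⟨α, hα, hαc⟩ := (hpl 0).exists_forall_mem_closedBall_eq_hasDerivWithinAt_continuousOn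
  simp only [zero_sub, zero_add] at hα hαc
  have hball : Metric.ball x₀ r ∈ 𝓝 x₀ := Metric.ball_mem_nhds _ hr
  have hIoo : Ioo (-ε) ε ∈ 𝓝 (0 : ℝ) := Ioo_mem_nhds (by linarith) hε
  have hprod : Metric.ball x₀ r ×ˢ Ioo (-ε) ε ∈ 𝓝 (x₀, (0 : ℝ)) := prod_mem_nhds hball hIoo
  refine ⟨α, ?_, ?_, ?_⟩
  swap
  · filter_upwards [hball] with x hx using (hα x (Metric.ball_subset_closedBall hx)).1
  swap
  · filter_upwards [hprod] with z hz
    exact ((hα z.1 (Metric.ball_subset_closedBall hz.1)).2 z.2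
      (Ioo_subset_Icc_self hz.2)).hasDerivAt (Icc_mem_nhds hz.2.1 hz.2.2)
  -- the implicit equation
  set fc : C(E, E) := ⟨f, hf.continuous⟩ with hfc
  let cst : E →L[ℝ] C(I, E) := ContinuousLinearMap.const ℝ I
  -- A zero of `G` at `((x, s), β)` solves β(t) = x + s ∫₀ᵗ f(β), so β is the integral curve through
  -- x run at speed s. Making time a parameter keeps the function space C(I, E) fixed.
  let G : (E × ℝ) × C(I, E) → C(I, E) := fun w ↦
    w.2 - cst w.1.1 - w.1.2 • primitiveL E (fc.comp w.2)
  have hN : ContDiff ℝ n (fun β : C(I, E) ↦ fc.comp β) := ContinuousMap.contDiff_postcomp n fc hf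
  have hG : ContDiff ℝ n G := by
    refine (contDiff_snd.sub (cst.contDiff.comp (contDiff_fst.comp contDiff_fst))).sub ?_
    exact (contDiff_snd.comp contDiff_fst).smul
      ((primitiveL E).contDiff.comp (hN.comp contDiff_snd))
  let u : (E × ℝ) × C(I, E) := ((x₀, 0), cst x₀)
  have hGu : G u = 0 := by simp [G, u]
  -- At s = 0 the integral term disappears, so the partial derivative in β is the identity.
  have hinv : (fderiv ℝ G u ∘L .inr ℝ (E × ℝ) C(I, E)).IsInvertible := by
    have h1 : HasFDerivAt G (fderiv ℝ G u) u :=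
      (hG.contDiffAt.differentiableAt hn0).hasFDerivAt
    have h2 : HasFDerivAt (fun β : C(I, E) ↦ G ((x₀, 0), β))
        (fderiv ℝ G u ∘L .inr ℝ (E × ℝ) C(I, E)) (cst x₀) :=
      HasFDerivAt.comp (cst x₀) (f := fun β : C(I, E) ↦ ((x₀, (0 : ℝ)), β)) h1
        (hasFDerivAt_prodMk_right _ _)
    have h3 : HasFDerivAt (fun β : C(I, E) ↦ G ((x₀, 0), β))
        (ContinuousLinearMap.id ℝ C(I, E)) (cst x₀) := by
      have : (fun β : C(I, E) ↦ G ((x₀, 0), β)) = fun β ↦ β - cst x₀ := by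
        funext β; simp [G]
      rw [this]
      exact (hasFDerivAt_id _).sub_const _
    rw [h2.unique h3]
    exact ⟨ContinuousLinearEquiv.refl ℝ _, rfl⟩
  have hcd : ContDiffAt ℝ n G u := hG.contDiffAt
  have hA := hcd.contDiffAt_implicitFunction hn0 hinv
  have hiff := hcd.eventually_apply_eq_iff_implicitFunction hn0 hinv
  set A := hcd.implicitFunction hn0 hinv with hAdef
  -- the rescaled integral curves
  have hmaps : ∀ z ∈ Metric.ball x₀ r ×ˢ Ioo (-ε) ε, ∀ t : I,
      (z.1, z.2 * (t : ℝ)) ∈ Metric.ball x₀ r ×ˢ Ioo (-ε) ε := by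
    rintro ⟨x, s⟩ ⟨hx, hs⟩ t
    refine ⟨hx, ?_⟩
    have hs' : |s| < ε := abs_lt.mpr hs
    refine abs_lt.mp ?_
    change |s * (t : ℝ)| < ε
    rw [abs_mul, abs_of_nonneg t.2.1]
    exact (mul_le_of_le_one_right (abs_nonneg s) t.2.2).trans_lt hs'
  have hsub : Metric.ball x₀ r ×ˢ Ioo (-ε) ε ⊆ Metric.closedBall x₀ r ×ˢ Icc (-ε) ε :=
    prod_mono Metric.ball_subset_closedBall Ioo_subset_Icc_self
  -- The implicit function captures only zeros near `u`. Continuity of the Picard–Lindelöf solution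
  -- shows that the rescaled curves are uniformly close to the constant curve at x₀.
  have hsmall : ∀ W ∈ 𝓝 u, ∀ᶠ z in 𝓝 (x₀, (0 : ℝ)), ∀ c : C(I, E),
      (∀ t : I, c t = α (z.1, z.2 * t)) → (z, c) ∈ W := by
    intro W hW
    obtain ⟨W1, hW1, W2, hW2, hWW⟩ := mem_nhds_prod_iff.mp hW
    obtain ⟨δ, hδ, hball2⟩ := Metric.mem_nhds_iff.mp hW2
    have hca : ContinuousAt α (x₀, 0) := hαc.continuousAt (Filter.mem_of_superset hprod hsub)
    have hα0 : α (x₀, 0) = x₀ := (hα x₀ (Metric.mem_closedBall_self r.2)).1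
    have hδ2 := Metric.continuousAt_iff.mp hca (δ / 2) (by positivity)
    obtain ⟨η, hη, hα2⟩ := hδ2
    filter_upwards [hW1, Metric.ball_mem_nhds (x₀, (0 : ℝ)) hη] with z hz1 hz2 c hc
    refine hWW ⟨hz1, hball2 ?_⟩
    refine lt_of_le_of_lt ((ContinuousMap.dist_le (by positivity : 0 ≤ δ / 2)).mpr ?_)
      (half_lt_self hδ)
    intro t
    rw [hc t]
    have : Dist.dist (z.1, z.2 * (t : ℝ)) (x₀, (0 : ℝ)) < η := by
      refine lt_of_le_of_lt ?_ hz2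
      rw [Prod.dist_eq, Prod.dist_eq]
      refine max_le_max le_rfl ?_
      rw [Real.dist_0_eq_abs, Real.dist_0_eq_abs, abs_mul, abs_of_nonneg t.2.1]
      exact mul_le_of_le_one_right (abs_nonneg _) t.2.2
    have h5 := (hα2 this).le
    rw [hα0] at h5
    exact h5
  -- The rescaled curve at parameter 1 is the flow at time s. Evaluation at 1 is linear and
  -- continuous, so `α` inherits the regularity of the implicit function.
  have hkey : ∀ᶠ z in 𝓝 (x₀, (0 : ℝ)), α z = A z 1 := by
    filter_upwards [hprod, hsmall _ hiff] with z hz hz2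
    have hcont : Continuous fun t : I ↦ α (z.1, z.2 * t) := by
      refine (hαc.mono hsub).comp_continuous (by fun_prop) (hmaps z hz)
    let c : C(I, E) := ⟨_, hcont⟩
    have h6 : (G (z, c) = G u ↔ A z = c) := hz2 c (fun _ ↦ rfl)
    have h7 : G (z, c) = G u := by
      rw [hGu]
      ext t
      have h8 : ∫ τ in (0 : ℝ)..t, z.2 • f (α (z.1, z.2 * τ)) = α (z.1, z.2 * t) - α (z.1, z.2 * 0) := by
        have hmem : ∀ τ ∈ uIcc (0 : ℝ) t, τ ∈ Icc (0 : ℝ) 1 := by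
          intro τ hτ
          rw [uIcc_of_le t.2.1] at hτ
          exact ⟨hτ.1, hτ.2.trans t.2.2⟩
        refine intervalIntegral.integral_eq_sub_of_hasDerivAt
          (f := fun τ ↦ α (z.1, z.2 * τ)) (fun τ hτ ↦ ?_) ?_
        · have hm := hmaps z hz ⟨τ, hmem τ hτ⟩
          have := ((hα z.1 (Metric.ball_subset_closedBall hz.1)).2 (z.2 * τ)
            (Ioo_subset_Icc_self hm.2)).hasDerivAt (Icc_mem_nhds hm.2.1 hm.2.2)
          exact this.scomp τ (by simpa using (hasDerivAt_id τ).const_mul z.2)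
        · refine ContinuousOn.intervalIntegrable ?_
          refine continuousOn_const.smul (hf.continuous.comp_continuousOn ?_)
          exact (hαc.mono hsub).comp (by fun_prop) (fun τ hτ ↦ hmaps z hz ⟨τ, hmem τ hτ⟩)
      have h9 : primitiveL E (fc.comp c) t = ∫ τ in (0 : ℝ)..t, f (α (z.1, z.2 * τ)) := by
        rw [primitiveL_apply]
        refine intervalIntegral.integral_congr fun τ hτ ↦ ?_
        rw [uIcc_of_le t.2.1] at hτ
        have : τ ∈ Icc (0 : ℝ) 1 := ⟨hτ.1, hτ.2.trans t.2.2⟩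
        simp [hfc, c, projIcc_of_mem zero_le_one this]
      rw [intervalIntegral.integral_smul] at h8
      have h10 : α (z.1, z.2 * 0) = z.1 := by
        rw [mul_zero]; exact (hα z.1 (Metric.ball_subset_closedBall hz.1)).1
      rw [h10] at h8
      simp [G, h9, h8, c, cst]
    have h11 := h6.mp h7
    rw [h11]
    simp [c]
  have hA1 : ContDiffAt ℝ n (fun z ↦ A z 1) (x₀, (0 : ℝ)) :=
    (ContinuousMap.evalCLM ℝ (1 : I) : C(I, E) →L[ℝ] E).contDiff.contDiffAt.comp _ hA
  have h12 : ContDiffAt ℝ n α (x₀, (0 : ℝ)) := hA1.congr_of_eventuallyEq hkey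
  exact h12.eventually (by simp)

end Flow

/-! ### Local and global flows on manifolds -/

section Flow

open Set

variable {E : Type*} [NormedAddCommGroup E] [NormedSpace ℝ E]

/-- A vector field that is `C^n` at a point of a finite-dimensional space has a local flow that is
jointly `C^n` in time and initial point. -/
theorem ContDiffAt.exists_local_flow [FiniteDimensional ℝ E] {n : ℕ} (hn : 1 ≤ n) {f : E → E}
    {x₀ : E}
    (hf : ContDiffAt ℝ n f x₀) :
    ∃ α : E × ℝ → E, (∀ᶠ z in 𝓝 (x₀, (0 : ℝ)), ContDiffAt ℝ n α z) ∧
      (∀ᶠ x in 𝓝 x₀, α (x, 0) = x) ∧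
      ∀ᶠ z in 𝓝 (x₀, (0 : ℝ)), HasDerivAt (fun t ↦ α (z.1, t)) (f (α z)) z.2 := by
  have hc : CompleteSpace E := FiniteDimensional.complete ℝ E
  have hev : ∀ᶠ x in 𝓝 x₀, ContDiffAt ℝ n f x := hf.eventually (by simp)
  obtain ⟨R, hR, hball⟩ := Metric.eventually_nhds_iff_ball.mp hev
  -- Cutting off makes the field globally `C^n` without changing it near x₀; the short-time flow
  -- stays where the two fields agree.
  let χ : ContDiffBump x₀ := ⟨R / 4, R / 2, by positivity, by linarith⟩
  let g : E → E := fun x ↦ χ x • f x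
  have hg : ContDiff ℝ n g := by
    rw [contDiff_iff_contDiffAt]
    intro x
    by_cases hx : x ∈ Metric.ball x₀ R
    · exact χ.contDiff.contDiffAt.smul (hball x hx)
    · have : g =ᶠ[𝓝 x] fun _ ↦ 0 := by
        have hx' : x ∉ tsupport χ := by
          rw [χ.tsupport_eq]
          intro h
          exact hx (Metric.closedBall_subset_ball (by change R / 2 < R; linarith) h)
        filter_upwards [notMem_tsupport_iff_eventuallyEq.mp hx'] with y hy
        simp [g, hy]
      exact contDiffAt_const.congr_of_eventuallyEq this
  have hgf : ∀ᶠ x in 𝓝 x₀, g x = f x := by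
    filter_upwards [χ.eventuallyEq_one] with x hx
    simp [g, hx]
  obtain ⟨α, h1, h2, h3⟩ := hg.exists_local_flow hn x₀
  refine ⟨α, h1, h2, ?_⟩
  have hcont : ContinuousAt α (x₀, 0) := h1.self_of_nhds.continuousAt
  have h0 : α (x₀, 0) = x₀ := h2.self_of_nhds
  have h4 : ∀ᶠ z in 𝓝 (x₀, (0 : ℝ)), g (α z) = f (α z) := by
    have := hcont.tendsto
    rw [h0] at this
    exact this.eventually hgf
  filter_upwards [h3, h4] with z hz hz'
  rwa [← hz']

theorem HasMFDerivAt.comp_curve {E' : Type*} [NormedAddCommGroup E'] [NormedSpace ℝ E']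
    {H : Type*} [TopologicalSpace H] {I : ModelWithCorners ℝ E' H}
    {N : Type*} [TopologicalSpace N] [ChartedSpace H N]
    {E'' : Type*} [NormedAddCommGroup E''] [NormedSpace ℝ E'']
    {H' : Type*} [TopologicalSpace H'] {J : ModelWithCorners ℝ E'' H'}
    {N' : Type*} [TopologicalSpace N'] [ChartedSpace H' N']
    {g : N → N'} {γ : ℝ → N} {t : ℝ} {v : TangentSpace I (γ t)}
    {L : TangentSpace I (γ t) →L[ℝ] TangentSpace J (g (γ t))} (hg : HasMFDerivAt I J g (γ t) L)
    (hγ : HasMFDerivAt 𝓘(ℝ, ℝ) I γ t ((1 : ℝ →L[ℝ] ℝ).smulRight v)) :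
    HasMFDerivAt 𝓘(ℝ, ℝ) J (fun s ↦ g (γ s)) t ((1 : ℝ →L[ℝ] ℝ).smulRight (L v)) := by
  refine (HasMFDerivAt.comp t hg hγ).congr_mfderiv ?_
  refine ContinuousLinearMap.ext fun s ↦ ?_
  exact map_smul L _ v

variable {M : Type*} [TopologicalSpace M] [ChartedSpace E M]

variable [IsManifold 𝓘(ℝ, E) ∞ M]

/-- The expression of a vector field in the chart at `p₀`. -/
def chartField (X : (p : M) → TangentSpace 𝓘(ℝ, E) p) (p₀ : M) (y : E) : E :=
  mfderiv 𝓘(ℝ, E) 𝓘(ℝ, E) (extChartAt 𝓘(ℝ, E) p₀) ((extChartAt 𝓘(ℝ, E) p₀).symm y)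
    (X ((extChartAt 𝓘(ℝ, E) p₀).symm y))

/-- The tangent bundle trivialization at `p₀` is the derivative of the chart at `p₀`, so the chart
expression is the trivialized section read through the inverse chart. -/
theorem contDiffAt_chartField {n : WithTop ℕ∞} [IsManifold 𝓘(ℝ, E) n M]
    {X : (p : M) → TangentSpace 𝓘(ℝ, E) p} {p₀ : M}
    (hX : ContMDiffAt 𝓘(ℝ, E) 𝓘(ℝ, E).tangent n
      (fun p ↦ (⟨p, X p⟩ : TangentBundle 𝓘(ℝ, E) M)) p₀) :
    ContDiffAt ℝ n (chartField X p₀) (extChartAt 𝓘(ℝ, E) p₀ p₀) := by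
  have h1 := (contMDiffAt_section (IB := 𝓘(ℝ, E)) p₀).mp hX
  have hsrc : ∀ᶠ p in 𝓝 p₀, p ∈ (chartAt E p₀).source :=
    (chartAt E p₀).open_source.mem_nhds (mem_chart_source E p₀)
  have h2 : ContMDiffAt 𝓘(ℝ, E) 𝓘(ℝ, E) n
      (fun p ↦ (mfderiv 𝓘(ℝ, E) 𝓘(ℝ, E) (extChartAt 𝓘(ℝ, E) p₀) p (X p) : E)) p₀ := by
    refine h1.congr_of_eventuallyEq ?_
    filter_upwards [hsrc] with p hp
    have e1 := DFunLike.congr_fun (TangentBundle.continuousLinearMapAt_trivializationAt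
      (I := 𝓘(ℝ, E)) hp) (X p)
    refine e1.symm.trans ?_
    rw [Trivialization.continuousLinearMapAt_apply, Trivialization.linearMapAt_apply, if_pos]
    simpa using hp
  have h3 : ContMDiffAt 𝓘(ℝ, E) 𝓘(ℝ, E) n (extChartAt 𝓘(ℝ, E) p₀).symm
      (extChartAt 𝓘(ℝ, E) p₀ p₀) :=
    (contMDiffOn_extChartAt_symm p₀).contMDiffAt (extChartAt_target_mem_nhds p₀)
  rw [← contMDiffAt_iff_contDiffAt]
  exact ContMDiffAt.comp (extChartAt 𝓘(ℝ, E) p₀ p₀) (by simpa using h2) h3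

theorem hasMFDerivAt_extChartAt_symm_comp
    {X : (p : M) → TangentSpace 𝓘(ℝ, E) p} (p₀ : M) {c : ℝ → E} {t : ℝ}
    (ht : c t ∈ (extChartAt 𝓘(ℝ, E) p₀).target)
    (hc : HasDerivAt c (chartField X p₀ (c t)) t) :
    HasMFDerivAt 𝓘(ℝ, ℝ) 𝓘(ℝ, E) (fun s ↦ (extChartAt 𝓘(ℝ, E) p₀).symm (c s)) t
      ((1 : ℝ →L[ℝ] ℝ).smulRight (X ((extChartAt 𝓘(ℝ, E) p₀).symm (c t)))) := by
  have h1 : MDifferentiableAt 𝓘(ℝ, E) 𝓘(ℝ, E) (extChartAt 𝓘(ℝ, E) p₀).symm (c t) := by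
    have := mdifferentiableWithinAt_extChartAt_symm (I := 𝓘(ℝ, E)) ht
    rwa [modelWithCornersSelf_coe, range_id, mdifferentiableWithinAt_univ] at this
  have h2' : HasFDerivAt c ((1 : ℝ →L[ℝ] ℝ).smulRight (chartField X p₀ (c t))) t :=
    hasDerivAt_iff_hasFDerivAt.mp hc
  have h2 := h2'.hasMFDerivAt
  have h3 := mfderivWithin_extChartAt_symm_comp_mfderiv_extChartAt (I := 𝓘(ℝ, E)) ht
  rw [modelWithCornersSelf_coe, range_id, mfderivWithin_univ] at h3
  have h4 := DFunLike.congr_fun h3 (X ((extChartAt 𝓘(ℝ, E) p₀).symm (c t)))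
  refine (HasMFDerivAt.comp_curve h1.hasMFDerivAt h2).congr_mfderiv ?_
  exact congrArg ((1 : ℝ →L[ℝ] ℝ).smulRight) h4

/-- A `C^n` vector field on a manifold has near each point a local flow that is jointly `C^n` in
time and initial point. -/
theorem exists_local_flow_of_contMDiffAt [FiniteDimensional ℝ E] {n : ℕ} (hn : 1 ≤ n)
    {X : (p : M) → TangentSpace 𝓘(ℝ, E) p} {p₀ : M}
    (hX : ContMDiffAt 𝓘(ℝ, E) 𝓘(ℝ, E).tangent n
      (fun p ↦ (⟨p, X p⟩ : TangentBundle 𝓘(ℝ, E) M)) p₀) :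
    ∃ β : M × ℝ → M,
      (∀ᶠ z in 𝓝 (p₀, (0 : ℝ)), ContMDiffAt (𝓘(ℝ, E).prod 𝓘(ℝ, ℝ)) 𝓘(ℝ, E) n β z) ∧
      (∀ᶠ p in 𝓝 p₀, β (p, 0) = p) ∧
      ∀ᶠ z in 𝓝 (p₀, (0 : ℝ)), HasMFDerivAt 𝓘(ℝ, ℝ) 𝓘(ℝ, E) (fun t ↦ β (z.1, t)) z.2
        ((1 : ℝ →L[ℝ] ℝ).smulRight (X (β z))) := by
  obtain ⟨α, h1, h2, h3⟩ := (contDiffAt_chartField hX).exists_local_flow hn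
  set ψ := extChartAt 𝓘(ℝ, E) p₀ with hψ
  have hψc : ContinuousAt ψ p₀ := continuousAt_extChartAt p₀
  have hlift : Filter.Tendsto (fun z : M × ℝ ↦ (ψ z.1, z.2)) (𝓝 (p₀, 0)) (𝓝 (ψ p₀, 0)) :=
    (ContinuousAt.prodMk (hψc.comp continuousAt_fst) continuousAt_snd : ContinuousAt
      (fun z : M × ℝ ↦ (ψ z.1, z.2)) (p₀, 0))
  have hα0 : α (ψ p₀, 0) = ψ p₀ := h2.self_of_nhds
  have htar : ∀ᶠ z in 𝓝 (ψ p₀, (0 : ℝ)), α z ∈ ψ.target := by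
    have hc : ContinuousAt α (ψ p₀, 0) := h1.self_of_nhds.continuousAt
    have := hc.tendsto
    rw [hα0] at this
    exact this (extChartAt_target_mem_nhds p₀)
  have hsrc : ∀ᶠ p in 𝓝 p₀, p ∈ ψ.source := extChartAt_source_mem_nhds p₀
  refine ⟨fun z ↦ ψ.symm (α (ψ z.1, z.2)), ?_, ?_, ?_⟩
  · filter_upwards [hlift.eventually h1, hlift.eventually htar,
      (continuousAt_fst (p := (p₀, (0 : ℝ)))).eventually hsrc] with z hz1 hz2 hz3
    have a1 : ContMDiffAt 𝓘(ℝ, E) 𝓘(ℝ, E) n ψ z.1 :=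
      contMDiffAt_extChartAt' (by simpa [hψ] using hz3)
    have a2 : ContMDiffAt (𝓘(ℝ, E).prod 𝓘(ℝ, ℝ)) 𝓘(ℝ, E × ℝ) n
        (fun z : M × ℝ ↦ (ψ z.1, z.2)) z :=
      (a1.comp z contMDiffAt_fst).prodMk_space contMDiffAt_snd
    have a3 : ContMDiffAt 𝓘(ℝ, E) 𝓘(ℝ, E) n ψ.symm (α (ψ z.1, z.2)) :=
      (contMDiffOn_extChartAt_symm p₀).contMDiffAt ((isOpen_extChartAt_target p₀).mem_nhds hz2)
    exact a3.comp z (hz1.contMDiffAt.comp z a2)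
  · filter_upwards [hψc.eventually h2, hsrc] with p hp1 hp2
    rw [hp1, ψ.left_inv hp2]
  · filter_upwards [hlift.eventually h3, hlift.eventually htar] with z hz1 hz2
    exact hasMFDerivAt_extChartAt_symm_comp p₀ hz2 hz1

/-- Near each point, integral curves of a smooth vector field exist for a uniform time. -/
theorem exists_uniform_time [FiniteDimensional ℝ E] {X : (p : M) → TangentSpace 𝓘(ℝ, E) p}
    (hX : ContMDiff 𝓘(ℝ, E) 𝓘(ℝ, E).tangent 1
      (fun p ↦ (⟨p, X p⟩ : TangentBundle 𝓘(ℝ, E) M))) (p₀ : M) :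
    ∃ ε > 0, ∀ᶠ p in 𝓝 p₀, ∃ γ : ℝ → M, γ 0 = p ∧ IsMIntegralCurveOn γ X (Ioo (-ε) ε) := by
  obtain ⟨β, -, h2, h3⟩ := exists_local_flow_of_contMDiffAt (n := 1) le_rfl
    (by exact_mod_cast hX p₀)
  obtain ⟨U, hU, V, hV, hUV⟩ := mem_nhds_prod_iff.mp h3
  obtain ⟨ε, hε, hball⟩ := Metric.mem_nhds_iff.mp hV
  refine ⟨ε, hε, ?_⟩
  filter_upwards [hU, h2] with p hp hp2
  refine ⟨fun t ↦ β (p, t), hp2, fun t ht ↦ ?_⟩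
  have hmem : (p, t) ∈ U ×ˢ V := ⟨hp, hball (by rw [Real.ball_eq_Ioo]; simpa using ht)⟩
  exact (hUV hmem : HasMFDerivAt _ _ _ _ _).hasMFDerivWithinAt

section Global

variable [T2Space M]

variable {X : (p : M) → TangentSpace 𝓘(ℝ, E) p} {φ : M → ℝ → M}

/-- Both sides are integral curves in `t` with the same value at `t = 0`, so uniqueness applies. -/
theorem integralFlow_add (hX : ContMDiff 𝓘(ℝ, E) 𝓘(ℝ, E).tangent 1
      (fun p ↦ (⟨p, X p⟩ : TangentBundle 𝓘(ℝ, E) M)))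
    (h0 : ∀ p, φ p 0 = p) (hφ : ∀ p, IsMIntegralCurve (φ p) X) (p : M) (s t : ℝ) :
    φ (φ p s) t = φ p (t + s) := by
  have h1 : IsMIntegralCurve (φ p ∘ (· + s)) X := (hφ p).comp_add s
  have := isMIntegralCurve_Ioo_eq_of_contMDiff_boundaryless (t₀ := 0) hX (hφ (φ p s)) h1
    (by simp [h0])
  exact congrFun this t

/-- The flow of a complete smooth vector field is smooth. -/
theorem contMDiff_integralFlow [FiniteDimensional ℝ E] (hX : ContMDiff 𝓘(ℝ, E) 𝓘(ℝ, E).tangent ∞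
      (fun p ↦ (⟨p, X p⟩ : TangentBundle 𝓘(ℝ, E) M)))
    (h0 : ∀ p, φ p 0 = p) (hφ : ∀ p, IsMIntegralCurve (φ p) X) :
    ContMDiff (𝓘(ℝ, E).prod 𝓘(ℝ, ℝ)) 𝓘(ℝ, E) ∞ (fun z : M × ℝ ↦ φ z.1 z.2) := by
  have hX1 : ContMDiff 𝓘(ℝ, E) 𝓘(ℝ, E).tangent 1
      (fun p ↦ (⟨p, X p⟩ : TangentBundle 𝓘(ℝ, E) M)) := hX.of_le (by norm_cast)
  -- Local flows are available for each finite order, but their time of existence may depend on the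
  -- order. Each order is therefore globalized separately.
  suffices H : ∀ n : ℕ, 1 ≤ n → ContMDiff (𝓘(ℝ, E).prod 𝓘(ℝ, ℝ)) 𝓘(ℝ, E) n
      (fun z : M × ℝ ↦ φ z.1 z.2) by
    rw [contMDiff_infty]
    intro n
    exact (H (n + 1) (by omega)).of_le (by norm_cast; omega)
  intro n hn
  -- the flow is `C^n` for small times
  have hloc : ∀ p₀ : M, ∃ U ∈ 𝓝 p₀, ∃ ε > 0, ∀ p ∈ U, ∀ t ∈ Ioo (-ε) ε,
      ContMDiffAt (𝓘(ℝ, E).prod 𝓘(ℝ, ℝ)) 𝓘(ℝ, E) n (fun z : M × ℝ ↦ φ z.1 z.2) (p, t) := by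
    intro p₀
    obtain ⟨β, h1, h2, h3⟩ := exists_local_flow_of_contMDiffAt hn
      (hX.of_le (m := n) (by exact_mod_cast le_top) p₀)
    obtain ⟨U, hU, V, hV, hUV⟩ := mem_nhds_prod_iff.mp (h1.and h3)
    obtain ⟨ε, hε, hball⟩ := Metric.mem_nhds_iff.mp hV
    rw [Real.ball_eq_Ioo, zero_sub, zero_add] at hball
    obtain ⟨W, hW, hWo, hpW⟩ := mem_nhds_iff.mp (Filter.inter_mem hU h2)
    have heq : ∀ p ∈ W, ∀ t ∈ Ioo (-ε) ε, φ p t = β (p, t) := by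
      intro p hp t ht
      refine isMIntegralCurveOn_Ioo_eqOn_of_contMDiff_boundaryless (t₀ := 0)
        ⟨by linarith, hε⟩ hX1 ((hφ p).isMIntegralCurveOn _) (γ' := fun t ↦ β (p, t)) ?_ ?_ ht
      · intro s hs
        exact (hUV (⟨(hW hp).1, hball hs⟩ : (p, s) ∈ U ×ˢ V)).2.hasMFDerivWithinAt
      · rw [h0]; exact (hW hp).2.symm
    refine ⟨W, hWo.mem_nhds hpW, ε, hε, fun p hp t ht ↦ ?_⟩
    refine (hUV (⟨(hW hp).1, hball ht⟩ : (p, t) ∈ U ×ˢ V)).1.congr_of_eventuallyEq ?_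
    filter_upwards [prod_mem_nhds (hWo.mem_nhds hp) (isOpen_Ioo.mem_nhds ht)] with z hz
    exact heq z.1 hz.1 z.2 hz.2
  rintro ⟨p, t⟩
  -- A connectedness argument in time: the set is open by definition, contains 0 by the local
  -- result, and is closed by the group law.
  let S : Set ℝ := {t | ∀ᶠ z in 𝓝 (p, t),
    ContMDiffAt (𝓘(ℝ, E).prod 𝓘(ℝ, ℝ)) 𝓘(ℝ, E) n (fun z : M × ℝ ↦ φ z.1 z.2) z}
  suffices hS : S = univ by
    have : t ∈ S := hS ▸ mem_univ t
    exact Filter.Eventually.self_of_nhds this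
  refine IsClopen.eq_univ ⟨?_, ?_⟩ ?_
  · refine isClosed_of_closure_subset fun t ht ↦ ?_
    obtain ⟨U, hU, ε, hε, hUε⟩ := hloc (φ p t)
    have hcont : Continuous (φ p) := (hφ p).continuous
    obtain ⟨s, ⟨hsU, hsε⟩, hsS⟩ := mem_closure_iff_nhds.mp ht
      (φ p ⁻¹' (interior U) ∩ Ioo (t - ε / 2) (t + ε / 2))
      (Filter.inter_mem (hcont.continuousAt (isOpen_interior.mem_nhds
        (mem_interior_iff_mem_nhds.mpr hU))) (Ioo_mem_nhds (by linarith) (by linarith)))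
    have hsS' : ∀ᶠ z in 𝓝 (p, s), ContMDiffAt (𝓘(ℝ, E).prod 𝓘(ℝ, ℝ)) 𝓘(ℝ, E) n
      (fun z : M × ℝ ↦ φ z.1 z.2) z := hsS
    have hs0 : ∀ᶠ q in 𝓝 p, ContMDiffAt 𝓘(ℝ, E) 𝓘(ℝ, E) n (fun q ↦ φ q s) q := by
      have hc : ContinuousAt (fun q : M ↦ (q, s)) p := by fun_prop
      filter_upwards [hc.eventually hsS'] with q hq
      exact hq.comp q (contMDiffAt_id.prodMk contMDiffAt_const)
    have hsU' : ∀ᶠ q in 𝓝 p, φ q s ∈ U := by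
      have := hs0.self_of_nhds.continuousAt
      exact this (mem_interior_iff_mem_nhds.mp hsU)
    have hev : ∀ᶠ z in 𝓝 (p, t), z.2 ∈ Ioo (t - ε / 2) (t + ε / 2) :=
      continuousAt_snd (Ioo_mem_nhds (by linarith) (by linarith))
    filter_upwards [hev, continuousAt_fst.eventually hs0, continuousAt_fst.eventually hsU']
      with z hz1 hz2 hz3
    -- Regularity at the limit time `t` comes from φ_t' = φ_(t'-s) ∘ φ_s: the time `s` is already
    -- good, and t' - s lies in the uniform window around `φ p t`.
    have hfun : (fun z : M × ℝ ↦ φ z.1 z.2)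
        = (fun z : M × ℝ ↦ φ z.1 z.2) ∘ fun z ↦ (φ z.1 s, z.2 - s) := by
      funext w
      simp [integralFlow_add hX1 h0 hφ]
    rw [hfun]
    refine ContMDiffAt.comp z (hUε (φ z.1 s) hz3 (z.2 - s) ⟨?_, ?_⟩) ?_
    · linarith [hz1.1, hsε.2]
    · linarith [hz1.2, hsε.1]
    · exact (hz2.comp z contMDiffAt_fst).prodMk
        ((contDiff_id.sub contDiff_const).contMDiff.contMDiffAt.comp z contMDiffAt_snd)
  · rw [isOpen_iff_mem_nhds]
    intro t ht
    have hc : ContinuousAt (fun s : ℝ ↦ (p, s)) t := by fun_prop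
    exact hc.eventually (eventually_eventually_nhds.mpr ht)
  · obtain ⟨U, hU, ε, hε, hUε⟩ := hloc p
    refine ⟨0, ?_⟩
    filter_upwards [prod_mem_nhds hU (Ioo_mem_nhds (neg_lt_zero.mpr hε) hε)] with z hz
    exact hUε z.1 hz.1 z.2 hz.2

end Global

end Flow

/-! ### Pullbacks of one-forms, naturality of d and the Poincaré lemma -/

namespace CauchyPair

open Set

variable {M : Type*} [TopologicalSpace M] [ChartedSpace R3 M]

/-- The pullback of a one-form along a map. -/
def OneForm.pullback {N : Type*} [TopologicalSpace N] [ChartedSpace R3 N] (η : OneForm M)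
    (f : N → M) : OneForm N :=
  fun p ↦ (η (f p)).comp (mfderiv (𝓡 3) (𝓡 3) f p)

/-- A one-form on `ℝ³` as a function with values in the dual of `ℝ³`. -/
def OneForm.coeff (η : OneForm R3) (q : R3) : R3 →L[ℝ] ℝ := η q

/-- The exterior derivative of a one-form on `ℝ³`, as an antisymmetrized derivative. -/
def curl (θ : R3 → R3 →L[ℝ] ℝ) (y v w : R3) : ℝ := fderiv ℝ θ y v w - fderiv ℝ θ y w v

theorem extDeriv_ofSubsingleton {θ : R3 → R3 →L[ℝ] ℝ} {y : R3} (hθ : DifferentiableAt ℝ θ y)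
    (v w : R3) :
    extDeriv (fun y ↦ ContinuousAlternatingMap.ofSubsingleton ℝ R3 ℝ (0 : Fin 1) (θ y)) y ![v, w]
      = curl θ y v w := by
  have hd : DifferentiableAt ℝ
      (fun y ↦ ContinuousAlternatingMap.ofSubsingleton ℝ R3 ℝ (0 : Fin 1) (θ y)) y :=
    (ContinuousAlternatingMap.ofSubsingletonLIE (𝕜 := ℝ) (E := R3) (F := ℝ)
      (0 : Fin 1)).toContinuousLinearEquiv.differentiableAt.comp y hθ
  rw [extDeriv_apply hd]
  simp [Fin.sum_univ_two, curl, Fin.removeNth]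
  have h (v : R3) : fderiv ℝ (fun y ↦ θ y v) y = (fderiv ℝ θ y).flip v := by
    ext w
    rw [fderiv_clm_apply hθ (differentiableAt_const v)]
    simp
  rw [h, h]
  simp [sub_eq_add_neg]

theorem curl_pullback {θ : R3 → R3 →L[ℝ] ℝ} {τ : R3 → R3} {y : R3}
    (hθ : DifferentiableAt ℝ θ (τ y)) (hτ : ContDiffAt ℝ ∞ τ y) (v w : R3) :
    curl (fun y ↦ (θ (τ y)).comp (fderiv ℝ τ y)) y v w
      = curl θ (τ y) (fderiv ℝ τ y v) (fderiv ℝ τ y w) := by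
  have hd : DifferentiableAt ℝ
      (fun y ↦ ContinuousAlternatingMap.ofSubsingleton ℝ R3 ℝ (0 : Fin 1) (θ y)) (τ y) :=
    (ContinuousAlternatingMap.ofSubsingletonLIE (𝕜 := ℝ) (E := R3) (F := ℝ)
      (0 : Fin 1)).toContinuousLinearEquiv.differentiableAt.comp _ hθ
  have h := extDeriv_pullback hd hτ (by rw [minSmoothness_of_isRCLikeNormedField]; norm_cast)
  have hdτ : DifferentiableAt ℝ (fderiv ℝ τ) y :=
    (hτ.fderiv_right (m := 1) (by norm_cast)).differentiableAt (by simp)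
  have hτd : DifferentiableAt ℝ τ y := hτ.differentiableAt (by simp)
  have hc : DifferentiableAt ℝ (fun y ↦ (θ (τ y)).comp (fderiv ℝ τ y)) y :=
    DifferentiableAt.clm_comp (hθ.comp y hτd) hdτ
  rw [← extDeriv_ofSubsingleton hθ, ← extDeriv_ofSubsingleton hc]
  have h2 := DFunLike.congr_fun h ![v, w]
  rw [ContinuousAlternatingMap.compContinuousLinearMap_apply] at h2
  have hv : ⇑(fderiv ℝ τ y) ∘ ![v, w] = ![fderiv ℝ τ y v, fderiv ℝ τ y w] := by
    funext i
    fin_cases i <;> rfl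
  rw [hv] at h2
  exact h2

variable [IsManifold (𝓡 3) ∞ M]

/-- On a constant vector `v` the pullback is η paired with the tangent map of ψ along `v`, both
smooth along ψ. -/
theorem OneForm.Smooth.contDiffOn_pullback {η : OneForm M} (hη : η.Smooth) {ψ : R3 → M}
    {O : Set R3} (hO : IsOpen O) (hψ : ContMDiffOn (𝓡 3) (𝓡 3) ∞ ψ O) :
    ContDiffOn ℝ ∞ (η.pullback ψ).coeff O := by
  rw [contDiffOn_clm_apply]
  intro v
  have h1 := hψ.contMDiffOn_tangentMapWithin (m := ∞) le_rfl hO.uniqueMDiffOn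
  have h2 : ContMDiff (𝓡 3) (𝓡 3).tangent ∞ (fun y : R3 ↦ (⟨y, v⟩ : TangentBundle (𝓡 3) R3)) :=
    contMDiff_vectorSpace_iff_contDiff.mpr contDiff_const
  have h3 := h1.comp h2.contMDiffOn (s := O) (fun y hy ↦ hy)
  have h4 := ContMDiffOn.clm_bundle_apply (IM := 𝓡 3) (IB := 𝓡 3) (b := ψ) (s := O)
    (F₁ := R3) (F₂ := ℝ) (E₁ := fun p : M ↦ TangentSpace (𝓡 3) p) (E₂ := Trivial M ℝ)
    (ϕ := fun y ↦ η (ψ y)) (v := fun y ↦ mfderivWithin (𝓡 3) (𝓡 3) ψ O y v)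
    (hη.comp_contMDiffOn hψ) h3
  intro y hy
  have h5 := (contMDiffWithinAt_totalSpace.mp (h4 y hy)).2
  refine h5.contDiffWithinAt.congr_of_mem (fun z hz ↦ ?_) hy
  change η (ψ z) (mfderiv (𝓡 3) (𝓡 3) ψ z v) = η (ψ z) (mfderivWithin (𝓡 3) (𝓡 3) ψ O z v)
  rw [mfderivWithin_of_isOpen hO hz]

/-- `OneForm.d` is defined through the chart preferred at each point. This lemma frees it from that
choice: with χ the chart at `ψ y`, the pullback by ψ is locally the pullback of the chart expression
by the map χ ∘ ψ of ℝ³, where naturality is `CauchyPair.curl_pullback`. -/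
theorem OneForm.Smooth.curl_pullback {η : OneForm M} (hη : η.Smooth) {ψ : R3 → M}
    {O : Set R3} (hO : IsOpen O) (hψ : ContMDiffOn (𝓡 3) (𝓡 3) ∞ ψ O) {y : R3} (hy : y ∈ O)
    (v w : R3) :
    curl (η.pullback ψ).coeff y v w
      = η.d (ψ y) (mfderiv (𝓡 3) (𝓡 3) ψ y v) (mfderiv (𝓡 3) (𝓡 3) ψ y w) := by
  set χ := extChartAt (𝓡 3) (ψ y) with hχ
  have hψy : ContMDiffAt (𝓡 3) (𝓡 3) ∞ ψ y := hψ.contMDiffAt (hO.mem_nhds hy)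
  have hτm : ContMDiffAt (𝓡 3) (𝓡 3) ∞ (fun z ↦ χ (ψ z)) y :=
    (contMDiffAt_extChartAt (I := 𝓡 3) (x := ψ y)).comp y hψy
  have hτ : ContDiffAt ℝ ∞ (fun z ↦ χ (ψ z)) y := hτm.contDiffAt
  have hsymm : ContMDiffOn (𝓡 3) (𝓡 3) ∞ χ.symm χ.target := contMDiffOn_extChartAt_symm (ψ y)
  have hopen : IsOpen χ.target := isOpen_extChartAt_target (ψ y)
  have hytar : χ (ψ y) ∈ χ.target := mem_extChartAt_target (ψ y)
  have hθ : DifferentiableAt ℝ (η.inChart (ψ y)) (χ (ψ y)) :=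
    ((hη.contDiffOn_pullback hopen hsymm).contDiffAt (hopen.mem_nhds hytar)).differentiableAt
      (by simp)
  have hmf : ∀ v : R3, mfderiv (𝓡 3) (𝓡 3) χ (ψ y) (mfderiv (𝓡 3) (𝓡 3) ψ y v)
      = fderiv ℝ (fun z ↦ χ (ψ z)) y v := by
    intro v
    rw [← mfderiv_eq_fderiv]
    have h := mfderiv_comp y (I' := 𝓡 3)
      ((contMDiffAt_extChartAt (I := 𝓡 3) (n := ∞) (x := ψ y)).mdifferentiableAt (by simp))
      (hψy.mdifferentiableAt (by simp))
    exact (DFunLike.congr_fun h v).symm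
  have hd : η.d (ψ y) (mfderiv (𝓡 3) (𝓡 3) ψ y v) (mfderiv (𝓡 3) (𝓡 3) ψ y w)
      = curl (η.inChart (ψ y)) (χ (ψ y)) (fderiv ℝ (fun z ↦ χ (ψ z)) y v)
        (fderiv ℝ (fun z ↦ χ (ψ z)) y w) := by
    rw [← extDeriv_ofSubsingleton hθ, OneForm.d, ← hmf v, ← hmf w]
  rw [hd, ← CauchyPair.curl_pullback hθ hτ]
  have heq : (η.pullback ψ).coeff =ᶠ[𝓝 y]
      fun z ↦ (η.inChart (ψ y) (χ (ψ z))).comp (fderiv ℝ (fun z ↦ χ (ψ z)) z) := by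
    filter_upwards [hO.mem_nhds hy,
      hψy.continuousAt (extChartAt_source_mem_nhds (I := 𝓡 3) (ψ y))] with z hzO hzs
    have hzs' : ψ z ∈ χ.source := hzs
    have hψz : MDifferentiableAt (𝓡 3) (𝓡 3) ψ z :=
      (hψ.contMDiffAt (hO.mem_nhds hzO)).mdifferentiableAt (by simp)
    have hχz : MDifferentiableAt (𝓡 3) (𝓡 3) χ (ψ z) :=
      (contMDiffAt_extChartAt' (n := ∞) (by simpa [hχ] using hzs')).mdifferentiableAt (by simp)
    have hzt : χ (ψ z) ∈ χ.target := χ.map_source hzs'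
    have hsz : MDifferentiableAt (𝓡 3) (𝓡 3) χ.symm (χ (ψ z)) :=
      (hsymm.contMDiffAt (hopen.mem_nhds hzt)).mdifferentiableAt (by simp)
    have hfun : ψ =ᶠ[𝓝 z] χ.symm ∘ fun z ↦ χ (ψ z) := by
      filter_upwards [hψz.continuousAt ((isOpen_extChartAt_source (I := 𝓡 3)
        (ψ y)).mem_nhds hzs')] with z' hz'
      exact (χ.left_inv hz').symm
    have h1 : mfderiv (𝓡 3) (𝓡 3) ψ z = mfderiv (𝓡 3) (𝓡 3) (χ.symm ∘ fun z ↦ χ (ψ z)) z :=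
      hfun.mfderiv_eq
    have h2 := mfderiv_comp z (I' := 𝓡 3) hsz (f := fun z ↦ χ (ψ z)) (hχz.comp z hψz)
    refine ContinuousLinearMap.ext fun v ↦ ?_
    have h3 : (mfderiv (𝓡 3) (𝓡 3) ψ z v : R3) = mfderiv (𝓡 3) (𝓡 3) χ.symm (χ (ψ z))
        (fderiv ℝ (fun z ↦ χ (ψ z)) z v) := by
      rw [← mfderiv_eq_fderiv]
      exact (DFunLike.congr_fun h1 v).trans (DFunLike.congr_fun h2 v)
    have h4 : χ.symm (χ (ψ z)) = ψ z := χ.left_inv hzs'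
    change η (ψ z) (mfderiv (𝓡 3) (𝓡 3) ψ z v)
      = η (χ.symm (χ (ψ z))) (mfderiv (𝓡 3) (𝓡 3) χ.symm (χ (ψ z))
        (fderiv ℝ (fun z ↦ χ (ψ z)) z v))
    -- The tangent spaces at `χ.symm (χ (ψ z))` and `ψ z` are distinct dependent types, so the base
    -- point is generalized before it is substituted.
    have h5 : ∀ (p : M) (hp : p = ψ z) (v v' : R3), v = v' →
        η (ψ z) v = η p v' := by
      rintro p rfl v v' rfl; rfl
    exact h5 _ h4 _ _ h3
  unfold curl
  rw [heq.fderiv_eq]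

theorem OneForm.smooth_of_contDiff {η : OneForm R3}
    (hη : ContDiff ℝ ∞ η.coeff) : η.Smooth := by
  intro q
  refine contMDiffAt_hom_bundle _ |>.mpr ⟨contMDiffAt_id, ?_⟩
  refine hη.contMDiff.contMDiffAt.congr_of_eventuallyEq (Filter.Eventually.of_forall fun y ↦ ?_)
  ext v
  simp [ContinuousLinearMap.inCoordinates]
  rfl

theorem OneForm.d_eq_curl {η : OneForm R3} (hη : η.Smooth) (q v w : R3) :
    η.d q v w = curl η.coeff q v w := by
  have h := hη.curl_pullback isOpen_univ (ψ := id) contMDiffOn_id (mem_univ q) v w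
  have h2 : η.pullback id = η := by
    funext p
    refine ContinuousLinearMap.ext fun v ↦ ?_
    change η p (mfderiv (𝓡 3) (𝓡 3) id p v) = _
    rw [mfderiv_id]
    rfl
  rw [h2, mfderiv_id] at h
  exact h.symm

theorem OneForm.Smooth.contDiff_coeff {η : OneForm R3} (hη : η.Smooth) :
    ContDiff ℝ ∞ η.coeff := by
  have h := hη.contDiffOn_pullback isOpen_univ (ψ := id) contMDiffOn_id
  have h2 : η.pullback id = η := by
    funext p
    refine ContinuousLinearMap.ext fun v ↦ ?_
    change η p (mfderiv (𝓡 3) (𝓡 3) id p v) = _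
    rw [mfderiv_id]
    rfl
  rwa [h2, contDiffOn_univ] at h

/-- A one-form that is locally the differential of smooth functions. -/
def OneForm.LocallyExact (η : OneForm M) : Prop :=
  ∀ p, ∃ U : Set M, IsOpen U ∧ p ∈ U ∧ ∃ g : M → ℝ, ContMDiffOn (𝓡 3) 𝓘(ℝ, ℝ) ∞ g U ∧
    ∀ q ∈ U, ∀ v : TangentSpace (𝓡 3) q, η q v = mfderiv (𝓡 3) 𝓘(ℝ, ℝ) g q v

/-- **Poincaré lemma** for a one-form whose local expressions are smooth and closed. -/
theorem OneForm.locallyExact_of_curl_eq_zero {η : OneForm M}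
    (hs : ∀ p, ContDiffOn ℝ ∞ (η.inChart p) (extChartAt (𝓡 3) p).target)
    (hc : ∀ p, ∀ y ∈ (extChartAt (𝓡 3) p).target, ∀ v w, curl (η.inChart p) y v w = 0) :
    η.LocallyExact := by
  intro p
  set χ := extChartAt (𝓡 3) p with hχ
  have hopen : IsOpen χ.target := isOpen_extChartAt_target p
  obtain ⟨r, hr, hball⟩ := Metric.isOpen_iff.mp hopen (χ p) (mem_extChartAt_target p)
  obtain ⟨f, hf⟩ := (convex_ball (χ p) r).exists_forall_hasFDerivAt_of_fderiv_symmetric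
    Metric.isOpen_ball (((hs p).differentiableOn (by simp)).mono hball)
    (fun a ha x y ↦ sub_eq_zero.mp (hc p a (hball ha) x y))
  have hfs : ContDiffOn ℝ ∞ f (Metric.ball (χ p) r) := by
    rw [contDiffOn_infty_iff_fderiv_of_isOpen Metric.isOpen_ball]
    exact ⟨fun a ha ↦ (hf a ha).differentiableAt.differentiableWithinAt,
      ((hs p).mono hball).congr fun a ha ↦ (hf a ha).fderiv⟩
  refine ⟨χ.source ∩ χ ⁻¹' Metric.ball (χ p) r,
    (continuousOn_extChartAt p).isOpen_inter_preimage (isOpen_extChartAt_source p)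
      Metric.isOpen_ball, ⟨mem_extChartAt_source p, Metric.mem_ball_self hr⟩, fun q ↦ f (χ q),
      ?_, ?_⟩
  · exact hfs.contMDiffOn.comp (contMDiffOn_extChartAt.mono
      (fun q hq ↦ by simpa [hχ] using hq.1)) (fun q hq ↦ hq.2)
  · intro q hq v
    have hχq : MDifferentiableAt (𝓡 3) (𝓡 3) χ q :=
      (contMDiffAt_extChartAt' (n := ∞) (by simpa [hχ] using hq.1)).mdifferentiableAt (by simp)
    have h1 : HasMFDerivAt (𝓡 3) 𝓘(ℝ, ℝ) f (χ q) (η.inChart p (χ q)) := (hf _ hq.2).hasMFDerivAt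
    have h2 := (HasMFDerivAt.comp q h1 hχq.hasMFDerivAt).mfderiv
    have h3 := mfderivWithin_extChartAt_symm_comp_mfderiv_extChartAt (I := 𝓡 3)
      (hball hq.2 : χ q ∈ χ.target)
    rw [modelWithCornersSelf_coe, range_id, mfderivWithin_univ] at h3
    have h4 : χ.symm (χ q) = q := χ.left_inv hq.1
    refine Eq.trans ?_ (DFunLike.congr_fun h2 v).symm
    change η q v = η (χ.symm (χ q)) (mfderiv (𝓡 3) (𝓡 3) χ.symm (χ q) (mfderiv (𝓡 3) (𝓡 3) χ q v))
    have h5 : ∀ (p' : M) (hp : p' = q)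
        (h : (mfderiv (𝓡 3) (𝓡 3) χ.symm (χ q)).comp (mfderiv (𝓡 3) (𝓡 3) χ p')
          = ContinuousLinearMap.id ℝ R3),
        η q v = η p' (mfderiv (𝓡 3) (𝓡 3) χ.symm (χ q) (mfderiv (𝓡 3) (𝓡 3) χ q v)) := by
      rintro p' rfl h
      exact congrArg (η p') (DFunLike.congr_fun h v).symm
    exact h5 _ h4 h3

/-- Closedness of η itself is not needed, only that dη vanishes on the image of the differential of
`f`. It serves for `f = id`, which gives x, and for the retraction onto a slice, which gives y and
z. -/
theorem OneForm.Smooth.locallyExact_pullback {η : OneForm M} (hη : η.Smooth) {f : M → M}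
    (hf : ContMDiff (𝓡 3) (𝓡 3) ∞ f)
    (hd : ∀ p (v w : TangentSpace (𝓡 3) p), η.d (f p) (mfderiv (𝓡 3) (𝓡 3) f p v)
      (mfderiv (𝓡 3) (𝓡 3) f p w) = 0) : (η.pullback f).LocallyExact := by
  have hsymm (p : M) : ContMDiffOn (𝓡 3) (𝓡 3) ∞ (extChartAt (𝓡 3) p).symm
    (extChartAt (𝓡 3) p).target := contMDiffOn_extChartAt_symm p
  have hopen (p : M) : IsOpen (extChartAt (𝓡 3) p).target := isOpen_extChartAt_target p
  have hmf (p : M) (y : R3) (hy : y ∈ (extChartAt (𝓡 3) p).target) :=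
    mfderiv_comp y (I' := 𝓡 3) (hf.mdifferentiableAt (by simp))
      (((hsymm p).contMDiffAt ((hopen p).mem_nhds hy)).mdifferentiableAt (by simp))
  have heq (p : M) : EqOn ((η.pullback f).inChart p)
      (η.pullback (f ∘ (extChartAt (𝓡 3) p).symm)).coeff (extChartAt (𝓡 3) p).target := by
    intro y hy
    refine ContinuousLinearMap.ext fun v ↦ ?_
    exact congrArg (η _) (DFunLike.congr_fun (hmf p y hy) v).symm
  have hcomp (p : M) := hf.comp_contMDiffOn (hsymm p)
  refine OneForm.locallyExact_of_curl_eq_zero (fun p ↦ ?_) (fun p y hy v w ↦ ?_)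
  · exact (hη.contDiffOn_pullback (hopen p) (hcomp p)).congr (heq p)
  · have h1 := ((heq p).eventuallyEq_of_mem ((hopen p).mem_nhds hy)).fderiv_eq (𝕜 := ℝ)
    have h2 := hη.curl_pullback (hopen p) (hcomp p) hy v w
    unfold curl at h2 ⊢
    rw [h1, h2, hmf p y hy]
    exact hd _ _ _

end CauchyPair

/-! ### Primitives on simply connected manifolds, by covering spaces -/

namespace CauchyPair

open Set

/-- The real numbers with the discrete topology. -/
@[ext]
structure DiscreteReal : Type where
  val : ℝ

instance : TopologicalSpace DiscreteReal := ⊥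

instance : DiscreteTopology DiscreteReal := ⟨rfl⟩

variable {M : Type*} [TopologicalSpace M] [ChartedSpace R3 M]

theorem eventually_eq_of_mfderiv_eq_zero {h : M → ℝ} {U : Set M} (hU : IsOpen U)
    [IsManifold (𝓡 3) ∞ M]
    (hd : ContMDiffOn (𝓡 3) 𝓘(ℝ, ℝ) ∞ h U)
    (h0 : ∀ q ∈ U, ∀ v : TangentSpace (𝓡 3) q, (mfderiv (𝓡 3) 𝓘(ℝ, ℝ) h q v : ℝ) = 0)
    {p : M} (hp : p ∈ U) : ∀ᶠ q in 𝓝 p, h q = h p := by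
  set χ := extChartAt (𝓡 3) p with hχ
  have hc : ContinuousAt χ.symm (χ p) := continuousAt_extChartAt_symm p
  have hχp : χ.symm (χ p) = p := extChartAt_to_inv p
  have hev : ∀ᶠ y in 𝓝 (χ p), y ∈ χ.target ∧ χ.symm y ∈ U := by
    refine Filter.Eventually.and (extChartAt_target_mem_nhds p) ?_
    refine hc.tendsto ?_
    rw [hχp]
    exact hU.mem_nhds hp
  obtain ⟨r, hr, hball⟩ := Metric.eventually_nhds_iff_ball.mp hev
  have hder : ∀ y ∈ Metric.ball (χ p) r, HasFDerivAt (fun y ↦ h (χ.symm y)) (0 : R3 →L[ℝ] ℝ) y := by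
    intro y hy
    obtain ⟨hy1, hy2⟩ := hball y hy
    have a1 : MDifferentiableAt (𝓡 3) (𝓡 3) χ.symm y :=
      ((contMDiffOn_extChartAt_symm (n := ∞) p).contMDiffAt
        ((isOpen_extChartAt_target p).mem_nhds hy1)).mdifferentiableAt (by simp)
    have a2 : MDifferentiableAt (𝓡 3) 𝓘(ℝ, ℝ) h (χ.symm y) :=
      (hd.contMDiffAt (hU.mem_nhds hy2)).mdifferentiableAt (by simp)
    have a3 := (HasMFDerivAt.comp y a2.hasMFDerivAt a1.hasMFDerivAt)
    refine (a3.congr_mfderiv ?_).hasFDerivAt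
    refine ContinuousLinearMap.ext fun v ↦ ?_
    exact h0 _ hy2 _
  have hconst : ∀ y ∈ Metric.ball (χ p) r, h (χ.symm y) = h p := by
    intro y hy
    have := (convex_ball (χ p) r).is_const_of_fderivWithin_eq_zero (𝕜 := ℝ)
      (f := fun y ↦ h (χ.symm y))
      (fun z hz ↦ (hder z hz).differentiableAt.differentiableWithinAt)
      (fun z hz ↦ by
        rw [fderivWithin_of_isOpen Metric.isOpen_ball hz]; exact (hder z hz).fderiv)
      hy (Metric.mem_ball_self hr)
    simpa [hχp] using this
  filter_upwards [extChartAt_source_mem_nhds (I := 𝓡 3) p,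
    (continuousAt_extChartAt (I := 𝓡 3) p) (Metric.ball_mem_nhds _ hr)] with q hq1 hq2
  have := hconst (χ q) hq2
  rwa [χ.left_inv hq1] at this

variable [IsManifold (𝓡 3) ∞ M]

/-- On a simply connected manifold, a locally exact one-form is exact. -/
theorem OneForm.LocallyExact.exists_primitive [SimplyConnectedSpace M] {η : OneForm M}
    (hη : η.LocallyExact) :
    ∃ g : M → ℝ, ContMDiff (𝓡 3) 𝓘(ℝ, ℝ) ∞ g ∧
      ∀ p (v : TangentSpace (𝓡 3) p), η p v = mfderiv (𝓡 3) 𝓘(ℝ, ℝ) g p v := by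
  choose U hUo hpU g hgs hgd using hη
  have hloc : LocallyPathConnectedSpace M := ChartedSpace.locallyPathConnectedSpace R3 M
  have hdiff (i j p : M) (hi : p ∈ U i) (hj : p ∈ U j) :
      ∀ᶠ q in 𝓝 p, g i q - g j q = g i p - g j p := by
    refine eventually_eq_of_mfderiv_eq_zero (h := fun q ↦ g i q - g j q)
      ((hUo i).inter (hUo j))
      (((hgs i).mono inter_subset_left).sub ((hgs j).mono inter_subset_right)) ?_ ⟨hi, hj⟩
    intro q hq v
    have b1 : MDifferentiableAt (𝓡 3) 𝓘(ℝ, ℝ) (g i) q :=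
      ((hgs i).contMDiffAt ((hUo i).mem_nhds hq.1)).mdifferentiableAt (by simp)
    have b2 : MDifferentiableAt (𝓡 3) 𝓘(ℝ, ℝ) (g j) q :=
      ((hgs j).contMDiffAt ((hUo j).mem_nhds hq.2)).mdifferentiableAt (by simp)
    have b3 := (b1.hasMFDerivAt.sub b2.hasMFDerivAt).mfderiv
    refine (DFunLike.congr_fun b3 v).trans ?_
    have b4 := hgd i q hq.1 v
    have b5 := hgd j q hq.2 v
    exact sub_eq_zero.mpr (b4.symm.trans b5)
  -- The bundle of germs of primitives: `t` over `q` in the trivialization `i` stands for the germ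
  -- at `q` of g_i + t. Two local primitives differ by a locally constant function, so the
  -- transition maps are continuous for the discrete topology on the fibre.
  let Z : FiberBundleCore M M DiscreteReal :=
    { baseSet := U
      isOpen_baseSet := hUo
      indexAt := id
      mem_baseSet_at := hpU
      coordChange := fun i j q t ↦ ⟨t.val + (g i q - g j q)⟩
      coordChange_self := fun i q _ t ↦ by
        ext
        simp
      continuousOn_coordChange := by
        rintro i j ⟨q, t⟩ ⟨⟨hi, hj⟩, -⟩
        refine ContinuousAt.continuousWithinAt ?_
        refine ContinuousAt.congr (f := fun _ ↦ (⟨t.val + (g i q - g j q)⟩ : DiscreteReal))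
          continuousAt_const ?_
        have h1 : ∀ᶠ z : M × DiscreteReal in 𝓝 (q, t), z.2 = t :=
          (continuousAt_snd (p := (q, t))).eventually (p := (· = t)) (by simp)
        have h2 : ∀ᶠ z : M × DiscreteReal in 𝓝 (q, t),
            g i z.1 - g j z.1 = g i q - g j q := 
          (continuousAt_fst (p := (q, t))).eventually (hdiff i j q hi hj)
        filter_upwards [h1, h2] with z hz1 hz2
        rw [hz1, hz2]
      coordChange_comp := fun i j k q _ t ↦ by
        ext
        dsimp only
        ring }
  have hcov : IsCoveringMap Z.proj := IsFiberBundle.isCoveringMap fun p ↦ ⟨Z.localTriv p, hpU p⟩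
  obtain ⟨a₀⟩ : Nonempty M := inferInstance
  -- Simple connectedness lifts the identity of `M` to a global section, that is, a coherent choice
  -- of local primitives. `G` below is the value of the chosen germ.
  obtain ⟨F, ⟨-, hF⟩, -⟩ := hcov.existsUnique_continuousMap_lifts (ContinuousMap.id M) a₀
    ⟨a₀, (⟨0⟩ : DiscreteReal)⟩ rfl
  have hF1 : ∀ q, (F q).1 = q := fun q ↦ congrFun hF q
  let c : M → M → ℝ := fun i q ↦ (Z.localTriv i (F q)).2.val
  let G : M → ℝ := fun q ↦ c q q + g q q
  have hG : ∀ i, ∀ q ∈ U i, G q = c i q + g i q := by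
    intro i q hq
    have hc : ∀ i, c i q = DiscreteReal.val (F q).2 + (g q q - g i q) := by
      intro i
      change DiscreteReal.val (F q).2 + (g (F q).1 (F q).1 - g i (F q).1) = _
      rw [hF1 q]
    change c q q + g q q = c i q + g i q
    rw [hc, hc i]
    ring
  have hcl : ∀ i, ∀ q ∈ U i, ∀ᶠ q' in 𝓝 q, c i q' = c i q := by
    intro i q hq
    have h1 : ContinuousAt (Z.localTriv i) (F q) :=
      (Z.localTriv i).continuousAt (by
        rw [(Z.localTriv i).mem_source]
        change (F q).1 ∈ U i
        rwa [hF1 q])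
    have h2 : ContinuousAt (fun q' ↦ (Z.localTriv i (F q')).2) q :=
      continuousAt_snd.comp (h1.comp F.continuous.continuousAt)
    have h3 := h2 (show {(Z.localTriv i (F q)).2} ∈ 𝓝 _ by simp)
    filter_upwards [h3] with q' hq' using congrArg DiscreteReal.val hq'
  have hGloc : ∀ p, G =ᶠ[𝓝 p] fun q ↦ c p p + g p q := by
    intro p
    filter_upwards [(hUo p).mem_nhds (hpU p), hcl p p (hpU p)] with q hq1 hq2
    rw [hG p q hq1, hq2]
  refine ⟨G, fun p ↦ ?_, fun p v ↦ ?_⟩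
  · exact (contMDiffAt_const.add ((hgs p).contMDiffAt ((hUo p).mem_nhds (hpU p)))).congr_of_eventuallyEq
      (hGloc p)
  · have b1 : MDifferentiableAt (𝓡 3) 𝓘(ℝ, ℝ) (g p) p :=
      ((hgs p).contMDiffAt ((hUo p).mem_nhds (hpU p))).mdifferentiableAt (by simp)
    have b2 := ((hasMFDerivAt_const (I := 𝓡 3) (I' := 𝓘(ℝ, ℝ)) (c p p) p).add
      b1.hasMFDerivAt).mfderiv
    rw [(hGloc p).mfderiv_eq]
    refine (hgd p p (hpU p) v).trans ?_
    have b3 := DFunLike.congr_fun b2 v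
    refine Eq.trans ?_ b3.symm
    exact (zero_add _).symm

end CauchyPair

/-! ### Smoothness of the dual frame -/

namespace CauchyPair

open Set

variable {M : Type*} [TopologicalSpace M] [ChartedSpace R3 M] [IsManifold (𝓡 3) ∞ M]

theorem Coframe.form_injective (e : Coframe M) {p : M} {v w : TangentSpace (𝓡 3) p}
    (h : ∀ i, e.form i p v = e.form i p w) : v = w :=
  (e.bijective p).injective (funext h)

theorem Coframe.eq_sharp (e : Coframe M) {p : M} {v : TangentSpace (𝓡 3) p} {j : Fin 3}
    (h : ∀ i, e.form i p v = if i = j then 1 else 0) : v = e.sharp j p :=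
  e.form_injective fun i ↦ by rw [h, e.form_sharp]

/-- The vector fields of the dual frame of a smooth coframe are smooth. -/
theorem Coframe.contMDiff_sharp (e : Coframe M) (j : Fin 3) :
    ContMDiff (𝓡 3) (𝓡 3).tangent ∞
      (fun p ↦ (⟨p, e.sharp j p⟩ : TangentBundle (𝓡 3) M)) := by
  intro p₀
  set χ := extChartAt (𝓡 3) p₀ with hχ
  have hopen : IsOpen χ.target := isOpen_extChartAt_target p₀
  have hsymm : ContMDiffOn (𝓡 3) (𝓡 3) ∞ χ.symm χ.target := contMDiffOn_extChartAt_symm p₀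
  -- `A` is the coframe matrix in the chart. The dual frame consists of the columns of its inverse,
  -- so smoothness of inversion of operators suffices.
  let A : R3 → R3 →L[ℝ] (Fin 3 → ℝ) := fun y ↦ ContinuousLinearMap.pi
    fun i ↦ ((e.form i).pullback χ.symm).coeff y
  have hA : ContDiffOn ℝ ∞ A χ.target := by
    rw [contDiffOn_clm_apply]
    intro v
    rw [contDiffOn_pi]
    intro i
    exact ((e.smooth i).contDiffOn_pullback hopen hsymm).clm_apply contDiffOn_const
  have hc1 (y : R3) (hy : y ∈ χ.target) :=
    mfderivWithin_extChartAt_symm_comp_mfderiv_extChartAt (I := 𝓡 3) (x := p₀) hy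
  have hc2 (y : R3) (hy : y ∈ χ.target) :=
    mfderiv_extChartAt_comp_mfderivWithin_extChartAt_symm (I := 𝓡 3) (x := p₀) hy
  simp only [modelWithCornersSelf_coe, range_id, mfderivWithin_univ] at hc1 hc2
  have hAinj : ∀ y ∈ χ.target, Function.Injective (A y) := by
    intro y hy v w hvw
    have h1 : mfderiv (𝓡 3) (𝓡 3) χ.symm y v = mfderiv (𝓡 3) (𝓡 3) χ.symm y w :=
      e.form_injective fun i ↦ congrFun hvw i
    have h2 := congrArg (mfderiv (𝓡 3) (𝓡 3) χ (χ.symm y)) h1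
    exact (DFunLike.congr_fun (hc2 y hy) v).symm.trans
      (h2.trans (DFunLike.congr_fun (hc2 y hy) w))
  have hy₀ : χ p₀ ∈ χ.target := mem_extChartAt_target p₀
  let L : R3 ≃L[ℝ] (Fin 3 → ℝ) := (LinearEquiv.ofInjectiveOfFinrankEq (A (χ p₀)).toLinearMap
    (hAinj _ hy₀) (by simp)).toContinuousLinearEquiv
  have hL : (L : R3 →L[ℝ] (Fin 3 → ℝ)) = A (χ p₀) := by
    ext v
    rfl
  have hinv : ∀ y ∈ χ.target, (A y).IsInvertible := by
    intro y hy
    refine ⟨(LinearEquiv.ofInjectiveOfFinrankEq (A y).toLinearMap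
      (hAinj _ hy) (by simp)).toContinuousLinearEquiv, ?_⟩
    ext v
    rfl
  have hV : ContDiffAt ℝ ∞ (fun y ↦ (A y).inverse (Pi.single j 1)) (χ p₀) := by
    have hi := contDiffAt_map_inverse (𝕜 := ℝ) (n := ∞) L
    rw [hL] at hi
    exact (hi.comp (χ p₀) (hA.contDiffAt (hopen.mem_nhds hy₀))).clm_apply contDiffAt_const
  rw [contMDiffAt_section]
  have hcomp : ContMDiffAt (𝓡 3) (𝓡 3) ∞ (fun q ↦ (A (χ q)).inverse (Pi.single j 1)) p₀ :=
    hV.contMDiffAt.comp p₀ (contMDiffAt_extChartAt (I := 𝓡 3))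
  refine hcomp.congr_of_eventuallyEq ?_
  filter_upwards [extChartAt_source_mem_nhds (I := 𝓡 3) p₀] with q hq
  have hq' : q ∈ (chartAt R3 p₀).source := by simpa using hq
  have e1 := DFunLike.congr_fun (TangentBundle.continuousLinearMapAt_trivializationAt
      (I := 𝓡 3) hq') (e.sharp j q)
  have hqt : χ q ∈ χ.target := χ.map_source hq
  have e2 : A (χ q) (mfderiv (𝓡 3) (𝓡 3) χ q (e.sharp j q)) = Pi.single j 1 := by
    funext i
    have h4 : χ.symm (χ q) = q := χ.left_inv hq
    have h5 : ∀ (p' : M) (hp : p' = q)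
        (h : (mfderiv (𝓡 3) (𝓡 3) χ.symm (χ q)).comp (mfderiv (𝓡 3) (𝓡 3) χ p')
          = ContinuousLinearMap.id ℝ R3),
        e.form i p' (mfderiv (𝓡 3) (𝓡 3) χ.symm (χ q) (mfderiv (𝓡 3) (𝓡 3) χ q (e.sharp j q)))
          = e.form i q (e.sharp j q) := by
      rintro p' rfl h
      exact congrArg (e.form i p') (DFunLike.congr_fun h (e.sharp j p'))
    have h6 := h5 _ h4 (hc1 (χ q) hqt)
    refine Eq.trans h6 ?_
    rw [e.form_sharp, Pi.single_apply]
  have e3 : (mfderiv (𝓡 3) (𝓡 3) χ q (e.sharp j q) : R3) = (A (χ q)).inverse (Pi.single j 1) := by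
    rw [← e2]
    obtain ⟨B, hB⟩ := hinv (χ q) hqt
    rw [← hB, ContinuousLinearMap.inverse_equiv]
    exact (B.symm_apply_apply _).symm
  refine Eq.trans ?_ e3
  refine Eq.trans ?_ e1
  symm
  rw [Trivialization.continuousLinearMapAt_apply, Trivialization.linearMapAt_apply, if_pos]
  simpa using hq

end CauchyPair

/-! ### Regularity and extension of integral curves -/

section IntegralCurve

open Set Filter

variable {E : Type*} [NormedAddCommGroup E] [NormedSpace ℝ E] [FiniteDimensional ℝ E]
  {M : Type*} [TopologicalSpace M] [ChartedSpace E M] [IsManifold 𝓘(ℝ, E) ∞ M]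
  {X : (p : M) → TangentSpace 𝓘(ℝ, E) p}

/-- Integral curves of a `C¹` vector field are `C¹`. -/
theorem IsMIntegralCurveOn.contMDiffOn_one (hX : ContMDiff 𝓘(ℝ, E) 𝓘(ℝ, E).tangent 1
      (fun p ↦ (⟨p, X p⟩ : TangentBundle 𝓘(ℝ, E) M)))
    {γ : ℝ → M} {s : Set ℝ} (hs : IsOpen s) (hγ : IsMIntegralCurveOn γ X s) :
    ContMDiffOn 𝓘(ℝ, ℝ) 𝓘(ℝ, E) 1 γ s := by
  intro t ht
  refine ContMDiffAt.contMDiffWithinAt ?_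
  have : CompleteSpace E := FiniteDimensional.complete ℝ E
  obtain ⟨β, h1, h2, h3⟩ := exists_local_flow_of_contMDiffAt (n := 1) le_rfl
    (by exact_mod_cast hX (γ t))
  have hc : ContinuousAt (fun s : ℝ ↦ (γ t, s - t)) t := by fun_prop
  have h4 : ContMDiffAt 𝓘(ℝ, ℝ) 𝓘(ℝ, E) 1 (fun s ↦ β (γ t, s - t)) t := by
    have h5 : ContMDiffAt (𝓘(ℝ, E).prod 𝓘(ℝ, ℝ)) 𝓘(ℝ, E) 1 β (γ t, t - t) := by
      rw [sub_self]; exact_mod_cast h1.self_of_nhds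
    exact h5.comp (f := fun s : ℝ ↦ (γ t, s - t)) t (contMDiffAt_const.prodMk
      (contDiff_id.sub contDiff_const).contMDiff.contMDiffAt)
  refine h4.congr_of_eventuallyEq ?_
  have hint : IsMIntegralCurveAt (fun s ↦ β (γ t, s)) X 0 := by
    have hc : ContinuousAt (fun s : ℝ ↦ (γ t, s)) 0 := by fun_prop
    exact hc.eventually h3
  have hint' : IsMIntegralCurveAt (fun s ↦ β (γ t, s - t)) X t := by
    have := IsMIntegralCurveAt.comp_add hint (-t)
    rwa [zero_sub, neg_neg] at this
  exact isMIntegralCurveAt_eventuallyEq_of_contMDiffAt_boundaryless (hX (γ t))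
    (hγ.isMIntegralCurveAt (hs.mem_nhds ht)) hint' (by simpa using h2.self_of_nhds.symm)

variable [T2Space M]

/-- If every integral curve on a bounded symmetric interval has limits at the end points, then the
vector field is complete. -/
theorem exists_isMIntegralCurve_of_tendsto (hX : ContMDiff 𝓘(ℝ, E) 𝓘(ℝ, E).tangent 1
      (fun p ↦ (⟨p, X p⟩ : TangentBundle 𝓘(ℝ, E) M)))
    (H : ∀ (γ : ℝ → M) (T : ℝ), IsMIntegralCurveOn γ X (Ioo (-T) T) → ∀ t : ℕ → ℝ,
      (∀ n, t n ∈ Ioo (-T) T) → CauchySeq t → ∃ q, Tendsto (fun n ↦ γ (t n)) atTop (𝓝 q))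
    (x : M) : ∃ γ : ℝ → M, γ 0 = x ∧ IsMIntegralCurve γ X := by
  -- The half-lengths of symmetric existence intervals. If they had a finite supremum `A`, it would
  -- be attained, and the limits at both ends would permit an extension beyond `A`.
  let s := {a | ∃ γ, γ 0 = x ∧ IsMIntegralCurveOn γ X (Ioo (-a) a)}
  suffices hbdd : ¬BddAbove s by
    rw [not_bddAbove_iff] at hbdd
    rw [exists_isMIntegralCurve_iff_exists_isMIntegralCurveOn_Ioo hX]
    intro a
    obtain ⟨y, ⟨γ, hγ1, hγ2⟩, hlt⟩ := hbdd a
    exact ⟨γ, hγ1, hγ2.mono <| Ioo_subset_Ioo (neg_le_neg hlt.le) hlt.le⟩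
  intro hbdd
  set A := sSup s with hA
  obtain ⟨ε₀, hε₀, h₀⟩ := exists_uniform_time hX x
  have hε₀s : ε₀ ∈ s := h₀.self_of_nhds
  have hApos : 0 < A := hε₀.trans_le (le_csSup hbdd hε₀s)
  -- the supremum is attained
  have hAs : ∃ γ, γ 0 = x ∧ IsMIntegralCurveOn γ X (Ioo (-A) A) := by
    have hex : ∀ a, a < A → ∃ γ, γ 0 = x ∧ IsMIntegralCurveOn γ X (Ioo (-a) a) := by
      intro a ha
      obtain ⟨b, ⟨γ, hγ1, hγ2⟩, hlt⟩ := exists_lt_of_lt_csSup ⟨ε₀, hε₀s⟩ ha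
      exact ⟨γ, hγ1, hγ2.mono <| Ioo_subset_Ioo (neg_le_neg hlt.le) hlt.le⟩
    have : Nonempty M := ⟨x⟩
    choose! γ hγ0 hγ using hex
    have heq : ∀ a b t, a < A → b < A → |t| < a → |t| < b → γ a t = γ b t := by
      intro a b t ha hb hta htb
      have hm : |t| < min a b := lt_min hta htb
      have hm0 : 0 < min a b := (abs_nonneg t).trans_lt hm
      refine isMIntegralCurveOn_Ioo_eqOn_of_contMDiff_boundaryless (t₀ := 0)
        (a := -min a b) (b := min a b) ⟨by linarith, hm0⟩ hX
        ((hγ a ha).mono (Ioo_subset_Ioo (neg_le_neg (min_le_left _ _)) (min_le_left _ _)))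
        ((hγ b hb).mono (Ioo_subset_Ioo (neg_le_neg (min_le_right _ _)) (min_le_right _ _)))
        (by rw [hγ0 a ha, hγ0 b hb]) (abs_lt.mp hm)
    refine ⟨fun t ↦ γ ((|t| + A) / 2) t, hγ0 _ (by rw [abs_zero]; linarith), fun t ht ↦ ?_⟩
    have ht' : |t| < A := abs_lt.mpr ht
    have hta : |t| < (|t| + A) / 2 := by linarith
    have haA : (|t| + A) / 2 < A := by linarith
    have h1 := (hγ _ haA t (abs_lt.mp hta)).hasMFDerivAt
      (Ioo_mem_nhds (abs_lt.mp hta).1 (abs_lt.mp hta).2)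
    refine HasMFDerivAt.hasMFDerivWithinAt
      (h1.congr_of_eventuallyEq (f₁ := fun t ↦ γ ((|t| + A) / 2) t) ?_)
    filter_upwards [Ioo_mem_nhds (abs_lt.mp hta).1 (abs_lt.mp hta).2] with r hr
    have hr' : |r| < (|t| + A) / 2 := abs_lt.mpr hr
    exact heq _ _ r (by linarith) haA (by linarith) hr'
  obtain ⟨γ, hγ0, hγ⟩ := hAs
  -- end points
  have hτ : ∀ n : ℕ, A * (1 - 1 / ((n : ℝ) + 2)) ∈ Ioo (-A) A := by
    intro n
    have h1 : 0 < 1 / ((n : ℝ) + 2) := by positivity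
    have h2 : 1 / ((n : ℝ) + 2) < 1 := by
      rw [div_lt_one (by positivity)]
      have : (0 : ℝ) ≤ n := n.cast_nonneg
      linarith
    constructor <;> nlinarith
  have hτlim : Tendsto (fun n : ℕ ↦ A * (1 - 1 / ((n : ℝ) + 2))) atTop (𝓝 A) := by
    have h1 : Tendsto (fun n : ℕ ↦ 1 / ((n : ℝ) + 2)) atTop (𝓝 0) := by
      have := (tendsto_one_div_add_atTop_nhds_zero_nat (𝕜 := ℝ)).comp (tendsto_add_atTop_nat 1)
      refine this.congr fun n ↦ ?_
      simp only [Function.comp_apply]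
      push_cast
      ring
    simpa using (h1.const_sub 1).const_mul A
  obtain ⟨q₂, hq₂⟩ := H γ A hγ _ hτ hτlim.cauchySeq
  obtain ⟨q₁, hq₁⟩ := H γ A hγ (fun n ↦ -(A * (1 - 1 / ((n : ℝ) + 2))))
    (fun n ↦ ⟨by linarith [(hτ n).2], by linarith [(hτ n).1]⟩) hτlim.neg.cauchySeq
  obtain ⟨ε₁, hε₁, h₁⟩ := exists_uniform_time hX q₁
  obtain ⟨ε₂, hε₂, h₂⟩ := exists_uniform_time hX q₂
  -- The curve is restarted at ±τ, both within ε/2 of ±A and with values near the end limits.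
  -- Running for time ε reaches beyond ±(A + ε/2); the bound ε ≤ A keeps the restart intervals on
  -- the correct side of 0.
  set ε := min ε₁ (min ε₂ A) with hε
  have hεpos : 0 < ε := lt_min hε₁ (lt_min hε₂ hApos)
  obtain ⟨n, ⟨γ₁', h1_aux, hγ1⟩, ⟨γ₂', h2_aux, hγ2⟩, hn⟩ := ((hq₁.eventually h₁).and
    ((hq₂.eventually h₂).and (hτlim.eventually
      (lt_mem_nhds (show A - ε / 2 < A by linarith))))).exists
  have hnA := (hτ n).2
  set τ := A * (1 - 1 / ((n : ℝ) + 2)) with hτdef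
  have hγ1' := hγ1.mono (Ioo_subset_Ioo (neg_le_neg (min_le_left ε₁ (min ε₂ A)))
    (min_le_left ε₁ (min ε₂ A)))
  have hε2 : ε ≤ ε₂ := (min_le_right _ _).trans (min_le_left _ _)
  have hεA : ε ≤ A := (min_le_right _ _).trans (min_le_right _ _)
  have hγ2' := hγ2.mono (Ioo_subset_Ioo (neg_le_neg hε2) hε2)
  rw [← hε, ← isMIntegralCurveOn_comp_add (dt := τ)] at hγ1'
  rw [← isMIntegralCurveOn_comp_sub (dt := τ)] at hγ2'
  set γ1 := γ₁' ∘ (· + τ) with γ1_def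
  set γ2 := γ₂' ∘ (· - τ) with γ2_def
  have heq1 : γ1 (-τ) = γ (-τ) := by simp [γ1_def, h1_aux]
  have heq2 : γ2 τ = γ τ := by simp [γ2_def, h2_aux]
  simp_rw [Set.mem_Ioo, ← sub_lt_iff_lt_add, ← lt_sub_iff_add_lt, ← Set.mem_Ioo] at hγ1'
  simp_rw [Set.mem_Ioo, lt_sub_iff_add_lt, sub_lt_iff_lt_add, ← Set.mem_Ioo] at hγ2'
  set γe : ℝ → M := piecewise (Ioo (-(A + ε / 2)) A) (piecewise (Ioo (-A) A) γ γ1) γ2 with γe_def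
  have h0e : γe 0 = x := by
    rw [γe_def, piecewise, if_pos ⟨by linarith, by linarith⟩, piecewise,
      if_pos ⟨by linarith, by linarith⟩, hγ0]
  suffices hext : IsMIntegralCurveOn γe X (Ioo (-(A + ε / 2)) (A + ε / 2)) from
    (not_lt.mpr <| le_csSup hbdd ⟨γe, h0e, hext⟩) <| lt_add_of_pos_right A (half_pos hεpos)
  apply (isMIntegralCurveOn_piecewise (t₀ := τ) hX _ hγ2'
      ⟨⟨by linarith, hnA⟩, ⟨by linarith, by linarith⟩⟩
      (by rw [piecewise, if_pos ⟨by linarith, hnA⟩, ← heq2])).mono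
    (Ioo_subset_Ioo_union_Ioo le_rfl (by linarith) (by linarith))
  exact (isMIntegralCurveOn_piecewise (t₀ := -τ) hX hγ hγ1'
      ⟨⟨by linarith, by linarith⟩, ⟨by linarith, by linarith⟩⟩ heq1.symm).mono
    (union_comm _ _ ▸ Ioo_subset_Ioo_union_Ioo (by linarith) (by linarith) le_rfl)

end IntegralCurve

/-! ### The Riemannian distance of a coframe and completeness of its frame fields -/

namespace CauchyPair

open Set Filter Manifold MeasureTheory

variable {M : Type*} [TopologicalSpace M] [ChartedSpace R3 M] [IsManifold (𝓡 3) ∞ M]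

theorem one_le_infty : (1 : WithTop ℕ∞) ≤ (∞ : WithTop ℕ∞) := by norm_cast

namespace Coframe

/-- The norm of the metric of a coframe. -/
abbrev toENorm (e : Coframe M) (x : M) : ENorm (TangentSpace (𝓡 3) x) :=
  ⟨fun v ↦ ENNReal.ofReal (Real.sqrt (e.metric x v v))⟩

theorem abs_form_le (e : Coframe M) (i : Fin 3) (p : M) (v : TangentSpace (𝓡 3) p) :
    |e.form i p v| ≤ Real.sqrt (e.metric p v v) := by
  refine Real.abs_le_sqrt ?_
  rw [sq]
  exact Finset.single_le_sum (f := fun i ↦ e.form i p v * e.form i p v)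
    (fun _ _ ↦ mul_self_nonneg _) (Finset.mem_univ i)

theorem metric_sharp_self (e : Coframe M) (j : Fin 3) (p : M) :
    e.metric p (e.sharp j p) (e.sharp j p) = 1 := by
  simp [metric, form_sharp]

theorem sum_form_smul_sharp (e : Coframe M) {p : M} (v : TangentSpace (𝓡 3) p) :
    ∑ i, e.form i p v • e.sharp i p = v := by
  refine e.form_injective fun j ↦ ?_
  simp [map_sum, form_sharp]

/-- Along an integral curve of a vector field of the dual frame, the distance is at most the
elapsed time. -/
theorem dist_le_of_isMIntegralCurveOn (e : Coframe M) (j : Fin 3) {γ : ℝ → M} {a b s t : ℝ}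
    (hγ : IsMIntegralCurveOn γ (e.sharp j) (Ioo a b)) (hs : s ∈ Ioo a b) (ht : t ∈ Ioo a b) :
    e.dist (γ s) (γ t) ≤ ENNReal.ofReal |t - s| := by
  let _ : ∀ x : M, ENorm (TangentSpace (𝓡 3) x) := e.toENorm
  have _ : ∀ x : M, ENormSMulClass ℝ (TangentSpace (𝓡 3) x) := fun x ↦ ⟨fun r v ↦ by
    change ENNReal.ofReal (Real.sqrt (e.metric x (r • v) (r • v)))
      = ‖r‖ₑ * ENNReal.ofReal (Real.sqrt (e.metric x v v))
    have h1 : e.metric x (r • v) (r • v) = r ^ 2 * e.metric x v v := by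
      simp only [metric, map_smul, smul_eq_mul, Finset.mul_sum]
      exact Finset.sum_congr rfl fun _ _ ↦ by ring
    rw [h1, Real.sqrt_mul (sq_nonneg r), Real.sqrt_sq_eq_abs, ENNReal.ofReal_mul (abs_nonneg r),
      Real.enorm_eq_ofReal_abs]⟩
  have hle : ∀ s ∈ Ioo a b, ∀ t ∈ Ioo a b, s ≤ t →
      riemannianEDist (𝓡 3) (γ s) (γ t) ≤ ENNReal.ofReal (t - s) := by
    intro s hs t ht hst
    have hsub : Icc s t ⊆ Ioo a b := fun r hr ↦ ⟨hs.1.trans_le hr.1, hr.2.trans_lt ht.2⟩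
    have hX := (e.contMDiff_sharp j).of_le one_le_infty
    have hC : ContMDiffOn 𝓘(ℝ, ℝ) (𝓡 3) 1 γ (Icc s t) :=
      (hγ.contMDiffOn_one hX isOpen_Ioo).mono hsub
    refine (riemannianEDist_le_pathELength hC rfl rfl hst).trans ?_
    rw [pathELength_eq_lintegral_mfderiv_Icc]
    calc _ = ∫⁻ r in Icc s t, 1 := by
          refine setLIntegral_congr_fun measurableSet_Icc fun r hr ↦ ?_
          have h1 := ((hγ r (hsub hr)).hasMFDerivAt (isOpen_Ioo.mem_nhds (hsub hr))).mfderiv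
          have h2 : mfderiv 𝓘(ℝ, ℝ) (𝓡 3) γ r (1 : ℝ) = e.sharp j (γ r) := by
            rw [h1]
            exact one_smul ℝ (e.sharp j (γ r))
          have h3 : ENNReal.ofReal (Real.sqrt (e.metric (γ r)
              (mfderiv 𝓘(ℝ, ℝ) (𝓡 3) γ r (1 : ℝ)) (mfderiv 𝓘(ℝ, ℝ) (𝓡 3) γ r (1 : ℝ)))) = 1 := by
            rw [h2, metric_sharp_self]
            simp
          exact h3
      _ ≤ _ := by simp
  change riemannianEDist (𝓡 3) (γ s) (γ t) ≤ _
  rcases le_total s t with h | h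
  · rw [abs_of_nonneg (sub_nonneg.mpr h)]
    exact hle s hs t ht h
  · rw [riemannianEDist_comm, abs_of_nonpos (sub_nonpos.mpr h), neg_sub]
    exact hle t ht s hs h

variable [T2Space M]

/-- Small balls of the Riemannian distance are contained in a given neighbourhood. -/
theorem exists_dist_lt_imp_mem (e : Coframe M) (p : M) {U : Set M} (hU : U ∈ 𝓝 p) :
    ∃ c : ℝ≥0∞, 0 < c ∧ ∀ q, e.dist q p < c → q ∈ U := by
  -- The bump function is 1 at `p` and supported in `U`. Its derivatives along the frame are bounded
  -- by some C, because of compact support, so it is 3C-Lipschitz for the Riemannian distance and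
  -- cannot drop to 0 on a short path.
  obtain ⟨f, -, hfU⟩ := (SmoothBumpFunction.nhds_basis_support (I := 𝓡 3) hU).mem_iff.mp hU
  have hf : ContMDiff (𝓡 3) 𝓘(ℝ, ℝ) ∞ f := f.contMDiff
  let a : Fin 3 → M → ℝ := fun i q ↦ (mfderiv (𝓡 3) 𝓘(ℝ, ℝ) f q (e.sharp i q) : ℝ)
  have ha : ∀ i, Continuous (a i) := by
    intro i
    have h1 : Continuous (tangentMap (𝓡 3) 𝓘(ℝ, ℝ) f) :=
      hf.continuous_tangentMap (by simp)
    have h2 := h1.comp (e.contMDiff_sharp i).continuous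
    have h3 : Continuous (fun z : TangentBundle 𝓘(ℝ, ℝ) ℝ ↦ (z.2 : ℝ)) :=
      continuous_snd.comp (tangentBundleModelSpaceHomeomorph 𝓘(ℝ, ℝ)).continuous
    exact h3.comp h2
  have hC : ∃ C : ℝ, 0 ≤ C ∧ ∀ i q, |a i q| ≤ C := by
    have hcomp : IsCompact (tsupport f) := f.hasCompactSupport
    have h1 : ∀ i, ∃ C, ∀ q ∈ tsupport f, ‖a i q‖ ≤ C := fun i ↦
      hcomp.exists_bound_of_continuousOn (ha i).continuousOn
    choose C hC using h1
    refine ⟨∑ i, |C i|, Finset.sum_nonneg fun _ _ ↦ abs_nonneg _, fun i q ↦ ?_⟩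
    by_cases hq : q ∈ tsupport f
    · exact ((hC i q hq).trans (le_abs_self _)).trans
        (Finset.single_le_sum (f := fun i ↦ |C i|) (fun _ _ ↦ abs_nonneg _) (Finset.mem_univ i))
    · have h2 : a i q = 0 := by
        have h3 := (notMem_tsupport_iff_eventuallyEq.mp hq).mfderiv_eq (I := 𝓡 3) (I' := 𝓘(ℝ, ℝ))
        have h4 : mfderiv (𝓡 3) 𝓘(ℝ, ℝ) f q = 0 := by
          rw [h3]
          exact mfderiv_const
        exact DFunLike.congr_fun h4 (e.sharp i q)
      rw [h2, abs_zero]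
      exact Finset.sum_nonneg fun _ _ ↦ abs_nonneg _
  obtain ⟨C, hC0, hC⟩ := hC
  let df (q : M) (v : TangentSpace (𝓡 3) q) : ℝ := mfderiv (𝓡 3) 𝓘(ℝ, ℝ) f q v
  have hbound : ∀ q (v : TangentSpace (𝓡 3) q),
      |df q v| ≤ 3 * C * Real.sqrt (e.metric q v v) := by
    intro q v
    have h1 : df q v = ∑ i, e.form i q v * a i q := by
      change (mfderiv (𝓡 3) 𝓘(ℝ, ℝ) f q v : ℝ) = _
      conv_lhs => rw [← e.sum_form_smul_sharp v]
      rw [map_sum]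
      exact Finset.sum_congr rfl fun i _ ↦ by rw [map_smul]; rfl
    rw [h1]
    refine (Finset.abs_sum_le_sum_abs _ _).trans ?_
    refine (Finset.sum_le_sum (g := fun _ ↦ Real.sqrt (e.metric q v v) * C) fun i _ ↦ ?_).trans ?_
    · rw [abs_mul]
      exact mul_le_mul (e.abs_form_le i q v) (hC i q) (abs_nonneg _) (Real.sqrt_nonneg _)
    · simp only [Finset.sum_const, Finset.card_univ, Fintype.card_fin]
      simp only [nsmul_eq_mul]
      push_cast
      linarith
  -- The radius makes the change of `f` at most 3C/(3C + 1) < 1; the added 1 also covers C = 0.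
  refine ⟨ENNReal.ofReal (1 / (3 * C + 1)), by simp; positivity, fun q hq ↦ ?_⟩
  let _ : ∀ x : M, ENorm (TangentSpace (𝓡 3) x) := e.toENorm
  obtain ⟨γ, hγ0, hγ1, hγC, hlen⟩ := exists_lt_of_riemannianEDist_lt (I := 𝓡 3) hq
  have hfγ : ContDiffOn ℝ 1 (fun t ↦ f (γ t)) (Icc 0 1) := by
    rw [← contMDiffOn_iff_contDiffOn]
    exact (hf.of_le one_le_infty).comp_contMDiffOn hγC
  have hineq := enorm_sub_le_lintegral_derivWithin_Icc_of_contDiffOn_Icc hfγ zero_le_one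
  have hlt : ‖f (γ 1) - f (γ 0)‖ₑ < 1 := by
    refine hineq.trans_lt ?_
    rw [pathELength_eq_lintegral_mfderivWithin_Icc] at hlen
    calc _ ≤ ∫⁻ t in Icc (0 : ℝ) 1, ENNReal.ofReal (3 * C)
            * ‖mfderivWithin 𝓘(ℝ, ℝ) (𝓡 3) γ (Icc 0 1) t (1 : ℝ)‖ₑ := by
          refine setLIntegral_mono' measurableSet_Icc fun t ht ↦ ?_
          have hu : UniqueMDiffWithinAt 𝓘(ℝ, ℝ) (Icc (0 : ℝ) 1) t :=
            (uniqueDiffOn_Icc zero_lt_one t ht).uniqueMDiffWithinAt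
          have h1 : mfderivWithin 𝓘(ℝ, ℝ) 𝓘(ℝ, ℝ) (f ∘ γ) (Icc 0 1) t
              = (mfderiv (𝓡 3) 𝓘(ℝ, ℝ) f (γ t)).comp
                (mfderivWithin 𝓘(ℝ, ℝ) (𝓡 3) γ (Icc 0 1) t) :=
            mfderiv_comp_mfderivWithin t (hf.mdifferentiableAt (by simp))
              (hγC.mdifferentiableOn one_ne_zero t ht) hu
          have h2 : derivWithin (fun t ↦ f (γ t)) (Icc 0 1) t
              = df (γ t) (mfderivWithin 𝓘(ℝ, ℝ) (𝓡 3) γ (Icc 0 1) t (1 : ℝ)) := by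
            rw [← fderivWithin_derivWithin, ← mfderivWithin_eq_fderivWithin]
            exact DFunLike.congr_fun h1 (1 : ℝ)
          rw [h2, Real.enorm_eq_ofReal_abs]
          refine (ENNReal.ofReal_le_ofReal (hbound _ _)).trans ?_
          rw [ENNReal.ofReal_mul (by positivity)]
          exact le_rfl
      _ = ENNReal.ofReal (3 * C) * ∫⁻ t in Icc (0 : ℝ) 1,
            ‖mfderivWithin 𝓘(ℝ, ℝ) (𝓡 3) γ (Icc 0 1) t (1 : ℝ)‖ₑ :=
          lintegral_const_mul' _ _ ENNReal.ofReal_ne_top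
      _ ≤ ENNReal.ofReal (3 * C) * ENNReal.ofReal (1 / (3 * C + 1)) := by
          gcongr
          exact hlen.le
      _ = ENNReal.ofReal (3 * C * (1 / (3 * C + 1))) := (ENNReal.ofReal_mul (by positivity)).symm
      _ < 1 := by
          rw [← ENNReal.ofReal_one, ENNReal.ofReal_lt_ofReal_iff one_pos, mul_one_div,
            div_lt_one (by positivity)]
          linarith
  apply hfU
  intro h0
  rw [hγ1, hγ0, h0, f.eq_one, sub_zero, enorm_one] at hlt
  exact lt_irrefl _ hlt

/-- The vector fields of the dual frame of a complete coframe are complete. -/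
theorem IsComplete.isCompleteField_sharp {e : Coframe M} (he : e.IsComplete) (j : Fin 3) :
    IsCompleteField (𝓡 3) (e.sharp j) := by
  refine exists_isMIntegralCurve_of_tendsto
    ((e.contMDiff_sharp j).of_le (by norm_cast)) fun γ T hγ t ht hc ↦ ?_
  have hcauchy : ∀ ε : ℝ≥0∞, 0 < ε →
      ∃ N, ∀ m ≥ N, ∀ n ≥ N, e.dist (γ (t m)) (γ (t n)) < ε := by
    intro ε hε
    obtain ⟨δ, hδ, hδε⟩ := ENNReal.lt_iff_exists_nnreal_btwn.mp hε
    have hδ' : 0 < (δ : ℝ) := by exact_mod_cast hδ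
    obtain ⟨N, hN⟩ := Metric.cauchySeq_iff.mp hc δ hδ'
    refine ⟨N, fun m hm n hn ↦ ?_⟩
    refine ((e.dist_le_of_isMIntegralCurveOn j hγ (ht m) (ht n)).trans ?_).trans_lt hδε
    rw [ENNReal.ofReal_le_iff_le_toReal (by simp)]
    have := hN n hn m hm
    rw [Real.dist_eq] at this
    simpa using this.le
  obtain ⟨q, hq⟩ := he _ hcauchy
  refine ⟨q, fun U hU ↦ ?_⟩
  -- Completeness gives a limit only for the distance; small distance balls inside `U` turn this
  -- into convergence in `M`.
  obtain ⟨c, hc0, hcU⟩ := e.exists_dist_lt_imp_mem q hU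
  exact (hq.eventually (gt_mem_nhds hc0)).mono fun n hn ↦ hcU _ hn

end Coframe

end CauchyPair

/-! ### The differential system and the normal form on ℝ³ -/

namespace CauchyPair

section NormalForm

/-- The dual frame of a coframe on `ℝ³`, as a family of vector-valued functions. -/
def Coframe.frame (ε : Coframe R3) (i : Fin 3) (q : R3) : R3 := ε.sharp i q

theorem Coframe.coeff_sharp (ε : Coframe R3) (i j : Fin 3) (q : R3) :
    (ε.form i).coeff q (ε.frame j q) = if i = j then 1 else 0 :=
  ε.form_sharp i j q

theorem fderiv_coeff_apply {η : OneForm R3} (hη : η.Smooth) (q v w : R3) :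
    fderiv ℝ (fun q' ↦ η.coeff q' v) q w = fderiv ℝ η.coeff q w v := by
  have hd : DifferentiableAt ℝ η.coeff q := (hη.contDiff_coeff.differentiable (by simp)) q
  have h := hd.hasFDerivAt.clm_apply (hasFDerivAt_const v q)
  rw [h.fderiv]
  simp

theorem lieX_eq {η : OneForm R3} (hη : η.Smooth) (q v : R3) :
    lieX η q v = fderiv ℝ η.coeff q ex v :=
  fderiv_coeff_apply hη q v ex

theorem lieXMetric_eq (ε : Coframe R3) (q v w : R3) :
    lieXMetric ε q v w
      = lieX (ε.form 1) q v * (ε.form 1).coeff q w + (ε.form 1).coeff q v * lieX (ε.form 1) q w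
        + (lieX (ε.form 2) q v * (ε.form 2).coeff q w
          + (ε.form 2).coeff q v * lieX (ε.form 2) q w) := by
  have hd (i : Fin 3) (v : R3) : DifferentiableAt ℝ (fun q' ↦ (ε.form i).coeff q' v) q :=
    ((ε.smooth i).contDiff_coeff.differentiable (by simp) q).clm_apply (differentiableAt_const v)
  have h := (((hd 1 v).hasFDerivAt.mul (hd 1 w).hasFDerivAt).add
    ((hd 2 v).hasFDerivAt.mul (hd 2 w).hasFDerivAt)).fderiv
  have h2 := DFunLike.congr_fun h ex
  simp only [add_apply, smul_apply, smul_eq_mul] at h2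
  refine Eq.trans h2 ?_
  simp only [lieX_eq (ε.smooth _), fderiv_coeff_apply (ε.smooth _)]
  ring

/-- The coframe `ε` has the form `(exp(u) dx, e_l, e_n)`, where `e_l` and `e_n` have no
`dx`-component. -/
structure IsAdapted (ε : Coframe R3) (u : R3 → ℝ) : Prop where
  form_zero : ∀ q v : R3, (ε.form 0).coeff q v = Real.exp (u q) * v 0
  form_ex : ∀ i : Fin 3, i ≠ 0 → ∀ q, (ε.form i).coeff q ex = 0

theorem ex_apply_zero : ex 0 = 1 := by simp [ex]

namespace IsAdapted

variable {ε : Coframe R3} {u : R3 → ℝ}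

theorem sharp_zero (h : IsAdapted ε u) (q : R3) :
    (ε.frame 0 q) = Real.exp (-u q) • ex := by
  symm
  refine ε.eq_sharp (p := q) (v := (Real.exp (-u q) • ex : R3)) fun i ↦ ?_
  change (ε.form i).coeff q (Real.exp (-u q) • ex) = _
  rw [map_smul]
  by_cases hi : i = 0
  · subst hi
    rw [h.form_zero, ex_apply_zero, smul_eq_mul, mul_one, ← Real.exp_add]
    simp
  · simp [h.form_ex i hi, hi]

theorem sharp_apply_zero (h : IsAdapted ε u) {j : Fin 3} (hj : j ≠ 0) (q : R3) :
    (ε.frame j q) 0 = 0 := by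
  have h1 := ε.coeff_sharp 0 j q
  rw [h.form_zero, if_neg hj.symm] at h1
  exact (mul_eq_zero.mp h1).resolve_left (Real.exp_ne_zero _)

theorem eq_add (h : IsAdapted ε u) (q v : R3) :
    v = v 0 • ex + (ε.form 1).coeff q v • (ε.frame 1 q)
      + (ε.form 2).coeff q v • (ε.frame 2 q) := by
  refine ε.form_injective (p := q) fun i ↦ ?_
  change (ε.form i).coeff q v = (ε.form i).coeff q (v 0 • ex
    + (ε.form 1).coeff q v • (ε.frame 1 q) + (ε.form 2).coeff q v • (ε.frame 2 q))
  rw [map_add, map_add, map_smul, map_smul, map_smul, ε.coeff_sharp, ε.coeff_sharp]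
  fin_cases i
  · simp [h.form_zero, ex_apply_zero, mul_comm]
  · simp [h.form_ex 1]
  · simp [h.form_ex 2]

theorem fderiv_ex (h : IsAdapted ε u) {i : Fin 3} (hi : i ≠ 0) (q w : R3) :
    fderiv ℝ (ε.form i).coeff q w ex = 0 := by
  rw [← fderiv_coeff_apply (ε.smooth i)]
  have : (fun q' ↦ (ε.form i).coeff q' ex) = fun _ ↦ 0 := funext (h.form_ex i hi)
  rw [this]
  simp

theorem d_zero (h : IsAdapted ε u) (hu : ContDiff ℝ ∞ u) (q v w : R3) :
    (ε.form 0).d q v w = fderiv ℝ u q v * (ε.form 0).coeff q w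
      - fderiv ℝ u q w * (ε.form 0).coeff q v := by
  have key (v w : R3) : fderiv ℝ (ε.form 0).coeff q v w
      = fderiv ℝ u q v * (ε.form 0).coeff q w := by
    rw [← fderiv_coeff_apply (ε.smooth 0)]
    have h1 : (fun q' ↦ (ε.form 0).coeff q' w) = fun q' ↦ Real.exp (u q') * w 0 :=
      funext fun q' ↦ h.form_zero q' w
    have hd : HasFDerivAt u (fderiv ℝ u q) q := (hu.differentiable (by simp) q).hasFDerivAt
    rw [h1, (hd.exp.mul_const (w 0)).fderiv, h.form_zero]
    simp only [smul_apply, smul_eq_mul]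
    ring
  rw [OneForm.d_eq_curl (ε.smooth 0), curl, key, key]

/-- Cartan's formula: e_i(∂_x) vanishes identically, so only the contraction of de_i with ∂_x
remains. -/
theorem d_ex (h : IsAdapted ε u) {i : Fin 3} (hi : i ≠ 0) (q w : R3) :
    (ε.form i).d q ex w = lieX (ε.form i) q w := by
  rw [OneForm.d_eq_curl (ε.smooth i), curl, h.fderiv_ex hi, sub_zero, lieX_eq (ε.smooth i)]

theorem lieX_ex (h : IsAdapted ε u) {i : Fin 3} (hi : i ≠ 0) (q : R3) :
    lieX (ε.form i) q ex = 0 := by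
  rw [lieX_eq (ε.smooth i), h.fderiv_ex hi]

theorem lieX_eq_add (h : IsAdapted ε u) {i : Fin 3} (hi : i ≠ 0) (q v : R3) :
    lieX (ε.form i) q v = (ε.form 1).coeff q v * lieX (ε.form i) q (ε.frame 1 q)
      + (ε.form 2).coeff q v * lieX (ε.form i) q (ε.frame 2 q) := by
  have h1 := h.lieX_ex hi q
  rw [lieX_eq (ε.smooth i)] at h1 ⊢
  conv_lhs => rw [h.eq_add q v]
  rw [lieX_eq (ε.smooth i), lieX_eq (ε.smooth i), map_add, map_add, map_smul, map_smul, map_smul,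
    h1]
  simp only [smul_eq_mul]
  ring

theorem fderiv_eq_add (h : IsAdapted ε u) (q v : R3) :
    fderiv ℝ u q v = v 0 * fderiv ℝ u q ex
      + (ε.form 1).coeff q v * fderiv ℝ u q (ε.frame 1 q)
      + (ε.form 2).coeff q v * fderiv ℝ u q (ε.frame 2 q) := by
  conv_lhs => rw [h.eq_add q v]
  simp only [map_add, map_smul, smul_eq_mul]

theorem normalTheta_eq (h : IsAdapted ε u) (hu : ContDiff ℝ ∞ u) (F : ℝ → ℝ) (q v w : R3) :
    normalTheta ε u F q v w
      = Real.exp (u q) * ((F (q 0) - fderiv ℝ u q ex) * (v 0 * w 0)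
        + v 0 * fderiv ℝ u q w + fderiv ℝ u q v * w 0)
        - 1 / 2 * Real.exp (-u q) * lieXMetric ε q v w := by
  have hd : HasFDerivAt u (fderiv ℝ u q) q := (hu.differentiable (by simp) q).hasFDerivAt
  have h1 : fderiv ℝ (fun q' ↦ Real.exp (-u q')) q ex = -(Real.exp (-u q) * fderiv ℝ u q ex) := by
    have h3 : HasFDerivAt (fun q' ↦ -u q') (-fderiv ℝ u q) q := hd.neg
    rw [h3.exp.fderiv]
    simp
  have h2 : Real.exp (-u q) * Real.exp (u q) = 1 := by rw [← Real.exp_add]; simp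
  have h3 (v : R3) : (ε.form 0 q v : ℝ) = Real.exp (u q) * v 0 := h.form_zero q v
  rw [normalTheta, h1, h3, h3]
  linear_combination (Real.exp (u q) * (F (q 0) - fderiv ℝ u q ex) * (v 0 * w 0)) * h2

/-- The two ∂_x u terms cancel and L_x h_x annihilates ∂_x, leaving Θ(e_u) = F dx + du. This is
exact, which yields the potential of a normal form. -/
theorem normalTheta_sharp_zero (h : IsAdapted ε u) (hu : ContDiff ℝ ∞ u) (F : ℝ → ℝ) (q w : R3) :
    normalTheta ε u F q (ε.frame 0 q) w = F (q 0) * w 0 + fderiv ℝ u q w := by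
  have h2 : Real.exp (u q) * Real.exp (-u q) = 1 := by rw [← Real.exp_add]; simp
  have hL (i : Fin 3) (hi : i ≠ 0) : lieX (ε.form i) q (Real.exp (-u q) • ex) = 0 := by
    rw [lieX_eq (ε.smooth i), map_smul, ← lieX_eq (ε.smooth i), h.lieX_ex hi, smul_zero]
  rw [h.normalTheta_eq hu, lieXMetric_eq, h.sharp_zero, hL 1 (by decide), hL 2 (by decide)]
  simp only [map_smul, h.form_ex 1 (by decide), h.form_ex 2 (by decide), PiLp.smul_apply,
    ex_apply_zero, smul_eq_mul]
  linear_combination (F (q 0) * w 0 + fderiv ℝ u q w) * h2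

end IsAdapted

theorem IsNormalCoframe.isAdapted {ε : Coframe R3} {u : R3 → ℝ} (h : IsNormalCoframe ε u) :
    IsAdapted ε u where
  form_zero := h.1
  form_ex i hi q := by
    fin_cases i
    · exact absurd rfl hi
    · exact h.2.1.1 q
    · exact h.2.2.1.1 q

/-- The symmetry condition says that the matrix of (L_x e_l, L_x e_n) in the frame is symmetric, so
the two halves of the Leibniz rule for L_x h_x agree. The factor 2 cancels the 1/2 in `normalTheta`.
-/
theorem IsNormalCoframe.lieXMetric_sharp {ε : Coframe R3} {u : R3 → ℝ}
    (h : IsNormalCoframe ε u) {i : Fin 3} (hi : i ≠ 0) (q w : R3) :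
    lieXMetric ε q (ε.frame i q) w = 2 * lieX (ε.form i) q w := by
  have hA := h.isAdapted
  have hs : lieX (ε.form 1) q (ε.frame 2 q) = lieX (ε.form 2) q (ε.frame 1 q) := h.2.2.2 q
  rw [lieXMetric_eq]
  fin_cases i
  · exact absurd rfl hi
  · simp only [Fin.mk_one, Coframe.coeff_sharp]
    rw [hA.lieX_eq_add (i := 1) (by decide) q w, ← hs]
    simp
    ring
  · simp only [Fin.reduceFinMk, Coframe.coeff_sharp]
    rw [hA.lieX_eq_add (i := 2) (by decide) q w, hs]
    simp
    ring

/-- The differential system satisfied by a coframe in normal form. -/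
theorem IsNormalCoframe.d_eq {ε : Coframe R3} {u : R3 → ℝ} (h : IsNormalCoframe ε u)
    (hu : ContDiff ℝ ∞ u) (F : ℝ → ℝ) (i : Fin 3) (q v w : R3) :
    (ε.form i).d q v w = normalTheta ε u F q (ε.frame i q) v * (ε.form 0).coeff q w
      - normalTheta ε u F q (ε.frame i q) w * (ε.form 0).coeff q v := by
  have hA := h.isAdapted
  by_cases hi : i = 0
  · subst hi
    rw [hA.d_zero hu, hA.normalTheta_sharp_zero hu, hA.normalTheta_sharp_zero hu, hA.form_zero,
      hA.form_zero]
    ring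
  · have hslice : ∀ v w : R3, v 0 = 0 → w 0 = 0 → curl (ε.form i).coeff q v w = 0 := by
      intro v w hv hw
      rw [← OneForm.d_eq_curl (ε.smooth i)]
      fin_cases i
      · exact absurd rfl hi
      · exact h.2.1.2 q v w hv hw
      · exact h.2.2.1.2 q v w hv hw
    have h0 : (ε.frame i q) 0 = 0 := hA.sharp_apply_zero hi q
    have h2 : Real.exp (u q) * Real.exp (-u q) = 1 := by rw [← Real.exp_add]; simp
    -- Removing the ∂_x-components makes both vectors tangent to the slice, where the form is
    -- closed. The remaining terms are Lie derivatives along ∂_x.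
    have h3 := hslice (v - v 0 • ex) (w - w 0 • ex) (by simp [ex_apply_zero])
      (by simp [ex_apply_zero])
    rw [OneForm.d_eq_curl (ε.smooth i), hA.normalTheta_eq hu, hA.normalTheta_eq hu,
      h.lieXMetric_sharp hi, h.lieXMetric_sharp hi, h0, hA.form_zero, hA.form_zero]
    simp only [curl, map_sub, map_smul, sub_apply, smul_apply, smul_eq_mul, hA.fderiv_ex hi,
      lieX_eq (ε.smooth i)] at h3 ⊢
    linear_combination h3 - (fderiv ℝ (ε.form i).coeff q ex w * v 0
      - fderiv ℝ (ε.form i).coeff q ex v * w 0) * h2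

/-- A solution of the differential system whose coframe is adapted to the coordinates is in normal
form. -/
theorem IsAdapted.isNormalCoframe {ε : Coframe R3} {u : R3 → ℝ} (h : IsAdapted ε u)
    (hu : ContDiff ℝ ∞ u) (T : R3 → R3 →L[ℝ] R3 →L[ℝ] ℝ) (hT : ∀ q v w, T q v w = T q w v)
    (h0 : ∀ q w, T q (ε.frame 0 q) w = fderiv ℝ u q w)
    (hd : ∀ (i : Fin 3) (q v w : R3), (ε.form i).d q v w
      = T q (ε.frame i q) v * (ε.form 0).coeff q w
        - T q (ε.frame i q) w * (ε.form 0).coeff q v) :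
    IsNormalCoframe ε u ∧ ∀ q v w, T q v w = normalTheta ε u (fun _ ↦ 0) q v w := by
  have hexp (q : R3) : Real.exp (-u q) * Real.exp (u q) = 1 := by rw [← Real.exp_add]; simp
  -- The system evaluated on (∂_x, w) determines the slice block of `T` through L_x e_i. Symmetry of
  -- `T` then becomes the symmetry condition of the normal form.
  have hL : ∀ i : Fin 3, i ≠ 0 → ∀ q w : R3, w 0 = 0 →
      lieX (ε.form i) q w = -(Real.exp (u q) * T q (ε.frame i q) w) := by
    intro i hi q w hw
    rw [← h.d_ex hi, hd, h.form_zero, h.form_zero, hw, ex_apply_zero]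
    ring
  have hslice : ∀ i : Fin 3, i ≠ 0 → IsClosedSliceFamily (ε.form i) := fun i hi ↦
    ⟨h.form_ex i hi, fun q v w hv hw ↦ by
      rw [hd, h.form_zero, h.form_zero, hv, hw]
      ring⟩
  have hLT : ∀ i j : Fin 3, i ≠ 0 → j ≠ 0 → ∀ q,
      lieX (ε.form i) q (ε.frame j q) = -(Real.exp (u q) * T q (ε.frame i q) (ε.frame j q)) :=
    fun i j hi hj q ↦ hL i hi q _ (h.sharp_apply_zero hj q)
  have hN : IsNormalCoframe ε u := by
    refine ⟨h.form_zero, hslice 1 (by decide), hslice 2 (by decide), fun q ↦ ?_⟩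
    change lieX (ε.form 1) q (ε.frame 2 q) = lieX (ε.form 2) q (ε.frame 1 q)
    rw [hLT 1 2 (by decide) (by decide), hLT 2 1 (by decide) (by decide), hT]
  refine ⟨hN, fun q v w ↦ ?_⟩
  -- The row of `T` along ∂_x is exp(u) du, with no F dx term, which is why F = 0. Together with
  -- symmetry and the slice block this determines `T`.
  have hex (w : R3) : T q ex w = Real.exp (u q) * fderiv ℝ u q w := by
    rw [← h0, h.sharp_zero, map_smul, smul_apply, smul_eq_mul, ← mul_assoc, mul_comm (Real.exp _),
      hexp, one_mul]
  have hTL : ∀ i j : Fin 3, i ≠ 0 → j ≠ 0 →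
      T q (ε.frame i q) (ε.frame j q) = -(Real.exp (-u q) * lieX (ε.form i) q (ε.frame j q)) := by
    intro i j hi hj
    rw [hLT i j hi hj]
    linear_combination (-T q (ε.frame i q) (ε.frame j q)) * hexp q
  have hTs (i : Fin 3) (hi : i ≠ 0) : T q (ε.frame i q) w
      = w 0 * (Real.exp (u q) * fderiv ℝ u q (ε.frame i q))
        - Real.exp (-u q) * lieX (ε.form i) q w := by
    conv_lhs => rw [h.eq_add q w]
    rw [map_add, map_add, map_smul, map_smul, map_smul, hT q _ ex, hex, hTL i 1 hi (by decide),
      hTL i 2 hi (by decide), h.lieX_eq_add hi q w]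
    simp only [smul_eq_mul]
    ring
  have hT1 : T q v w = v 0 * T q ex w + (ε.form 1).coeff q v * T q (ε.frame 1 q) w
      + (ε.form 2).coeff q v * T q (ε.frame 2 q) w := by
    conv_lhs => rw [h.eq_add q v]
    simp only [map_add, map_smul, add_apply, smul_apply, smul_eq_mul]
  have hsym : lieX (ε.form 1) q (ε.frame 2 q) = lieX (ε.form 2) q (ε.frame 1 q) := hN.2.2.2 q
  rw [hT1, hTs 1 (by decide), hTs 2 (by decide), hex, h.normalTheta_eq hu, lieXMetric_eq,
    h.lieX_eq_add (i := 1) (by decide) q v, h.lieX_eq_add (i := 1) (by decide) q w,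
    h.lieX_eq_add (i := 2) (by decide) q v, h.lieX_eq_add (i := 2) (by decide) q w, hsym,
    h.fderiv_eq_add q v]
  ring

end NormalForm

end CauchyPair

/-! ### From the normal form back to the manifold -/

namespace CauchyPair

variable {M : Type*} [TopologicalSpace M] [ChartedSpace R3 M]

theorem mfderiv_apply_mfderiv_symm (φ : M ≃ₘ^∞⟮𝓡 3, 𝓡 3⟯ R3) (q v : R3) :
    (mfderiv (𝓡 3) (𝓡 3) φ (φ.symm q) (mfderiv (𝓡 3) (𝓡 3) φ.symm q v) : R3) = v := by
  have h1 := mfderiv_comp q (φ.contMDiff.mdifferentiableAt (x := φ.symm q) (by simp))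
    (φ.symm.contMDiff.mdifferentiableAt (x := q) (by simp))
  have h2 : (φ ∘ φ.symm : R3 → R3) = id := funext φ.apply_symm_apply
  rw [h2, mfderiv_id] at h1
  exact (DFunLike.congr_fun h1 v).symm

theorem mfderiv_symm_apply_mfderiv (φ : M ≃ₘ^∞⟮𝓡 3, 𝓡 3⟯ R3) (q : R3)
    (v : TangentSpace (𝓡 3) (φ.symm q)) :
    mfderiv (𝓡 3) (𝓡 3) φ.symm q (mfderiv (𝓡 3) (𝓡 3) φ (φ.symm q) v : R3) = v := by
  have h1 := mfderiv_comp_of_eq (x := φ.symm q) (φ.symm.contMDiff.mdifferentiableAt (by simp))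
    (φ.contMDiff.mdifferentiableAt (by simp)) (φ.apply_symm_apply q)
  have h2 : (φ.symm ∘ φ : M → M) = id := funext φ.symm_apply_apply
  rw [h2, mfderiv_id] at h1
  have h3 : ∀ q' : R3, q' = q → (mfderiv (𝓡 3) (𝓡 3) φ.symm q'
      (mfderiv (𝓡 3) (𝓡 3) φ (φ.symm q) v : R3) : R3)
        = mfderiv (𝓡 3) (𝓡 3) φ.symm q (mfderiv (𝓡 3) (𝓡 3) φ (φ.symm q) v : R3) := by
    rintro _ rfl
    rfl
  exact (h3 _ (φ.apply_symm_apply q)).symm.trans (DFunLike.congr_fun h1 v).symm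

namespace HasNormalForm

variable [IsManifold (𝓡 3) ∞ M] {e : Coframe M} {Θ : ShapeOperator M} {φ : M ≃ₘ^∞⟮𝓡 3, 𝓡 3⟯ R3} {ε : Coframe R3}
  {u : R3 → ℝ} {F : ℝ → ℝ}

theorem mfderiv_sharp (h : HasNormalForm e Θ φ ε u F) (i : Fin 3) (p : M) :
    (mfderiv (𝓡 3) (𝓡 3) φ p (e.sharp i p) : R3) = ε.frame i (φ p) :=
  ε.eq_sharp fun j ↦ by rw [← h.coframe, e.form_sharp]

theorem form_mfderiv_symm (h : HasNormalForm e Θ φ ε u F) (i : Fin 3) (q v : R3) :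
    e.form i (φ.symm q) (mfderiv (𝓡 3) (𝓡 3) φ.symm q v) = (ε.form i).coeff q v := by
  rw [h.coframe]
  change (ε.form i).coeff (φ (φ.symm q))
    (mfderiv (𝓡 3) (𝓡 3) φ (φ.symm q) (mfderiv (𝓡 3) (𝓡 3) φ.symm q v) : R3) = _
  rw [mfderiv_apply_mfderiv_symm, φ.apply_symm_apply]

theorem d_form (h : HasNormalForm e Θ φ ε u F) (i : Fin 3) (p : M) (v w : TangentSpace (𝓡 3) p) :
    (e.form i).d p v w = (ε.form i).d (φ p) (mfderiv (𝓡 3) (𝓡 3) φ p v)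
      (mfderiv (𝓡 3) (𝓡 3) φ p w) := by
  obtain ⟨q, rfl⟩ : ∃ q, φ.symm q = p := ⟨φ p, φ.symm_apply_apply p⟩
  have h1 : (e.form i).pullback φ.symm = ε.form i :=
    funext fun q ↦ ContinuousLinearMap.ext fun v ↦ h.form_mfderiv_symm i q v
  have h2 := (e.smooth i).curl_pullback isOpen_univ
    (φ.symm.contMDiff.contMDiffOn (s := Set.univ)) (Set.mem_univ q)
    (mfderiv (𝓡 3) (𝓡 3) φ (φ.symm q) v) (mfderiv (𝓡 3) (𝓡 3) φ (φ.symm q) w)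
  rw [h1, mfderiv_symm_apply_mfderiv, mfderiv_symm_apply_mfderiv] at h2
  refine h2.symm.trans (Eq.trans ?_ (OneForm.d_eq_curl (ε.smooth i) _ _ _).symm)
  rw [φ.apply_symm_apply]

/-- The potential of a pair in normal form, in the coordinates. -/
def potential (u : R3 → ℝ) (F : ℝ → ℝ) (q : R3) : ℝ := -(u q + ∫ s in (0 : ℝ)..(q 0), F s)

theorem contDiff_primitive (hF : ContDiff ℝ ∞ F) :
    ContDiff ℝ ∞ (fun x ↦ ∫ s in (0 : ℝ)..x, F s) := by
  have hd (x : ℝ) : HasDerivAt (fun x ↦ ∫ s in (0 : ℝ)..x, F s) (F x) x :=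
    intervalIntegral.integral_hasDerivAt_right (hF.continuous.intervalIntegrable _ _)
      hF.continuous.aestronglyMeasurable.stronglyMeasurableAtFilter hF.continuous.continuousAt
  rw [contDiff_infty_iff_deriv]
  refine ⟨fun x ↦ (hd x).differentiableAt, ?_⟩
  rwa [show deriv (fun x ↦ ∫ s in (0 : ℝ)..x, F s) = F from funext fun x ↦ (hd x).deriv]

theorem contDiff_potential (hu : ContDiff ℝ ∞ u) (hF : ContDiff ℝ ∞ F) :
    ContDiff ℝ ∞ (potential u F) := by
  have h0 : ContDiff ℝ ∞ (fun q : R3 ↦ q 0) := (EuclideanSpace.proj (𝕜 := ℝ) (0 : Fin 3)).contDiff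
  exact (hu.add ((contDiff_primitive hF).comp h0)).neg

theorem fderiv_potential (hu : ContDiff ℝ ∞ u) (hF : ContDiff ℝ ∞ F) (q w : R3) :
    fderiv ℝ (potential u F) q w = -(F (q 0) * w 0 + fderiv ℝ u q w) := by
  have hd : HasDerivAt (fun x ↦ ∫ s in (0 : ℝ)..x, F s) (F (q 0)) (q 0) :=
    intervalIntegral.integral_hasDerivAt_right (hF.continuous.intervalIntegrable _ _)
      hF.continuous.aestronglyMeasurable.stronglyMeasurableAtFilter hF.continuous.continuousAt
  have h0 : HasFDerivAt (fun q : R3 ↦ q 0) (EuclideanSpace.proj (𝕜 := ℝ) (0 : Fin 3)) q :=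
    (EuclideanSpace.proj (𝕜 := ℝ) (0 : Fin 3)).hasFDerivAt
  have hu' : HasFDerivAt u (fderiv ℝ u q) q := (hu.differentiable (by simp) q).hasFDerivAt
  have h1 : HasFDerivAt (potential u F) _ q := (hu'.add (hd.comp_hasFDerivAt (f := fun q : R3 ↦ q 0) q h0)).neg
  rw [h1.fderiv]
  simp
  ring

theorem isPotential (h : HasNormalForm e Θ φ ε u F) :
    IsPotential e Θ (fun p ↦ potential u F (φ p)) := by
  have hg := contDiff_potential h.contDiff_u h.contDiff_F
  refine ⟨hg.contMDiff.comp φ.contMDiff, fun p v ↦ ?_⟩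
  have h1 : mfderiv (𝓡 3) 𝓘(ℝ, ℝ) (fun p ↦ potential u F (φ p)) p
      = (mfderiv (𝓡 3) 𝓘(ℝ, ℝ) (potential u F) (φ p)).comp (mfderiv (𝓡 3) (𝓡 3) φ p) :=
    mfderiv_comp p (hg.contMDiff.mdifferentiableAt (by simp))
      (φ.contMDiff.mdifferentiableAt (by simp))
  have h2 : (mfderiv (𝓡 3) 𝓘(ℝ, ℝ) (fun p ↦ potential u F (φ p)) p v : ℝ)
      = fderiv ℝ (potential u F) (φ p) (mfderiv (𝓡 3) (𝓡 3) φ p v : R3) := by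
    rw [← mfderiv_eq_fderiv]
    exact DFunLike.congr_fun h1 v
  have h3 := h.theta p (e.sharp 0 p) v
  rw [h.mfderiv_sharp] at h3
  rw [thetaForm, h3.trans (h.normal.isAdapted.normalTheta_sharp_zero h.contDiff_u F _ _), h2]
  exact (neg_eq_iff_eq_neg.mpr (fderiv_potential h.contDiff_u h.contDiff_F _ _)).symm

theorem isParallel (h : HasNormalForm e Θ φ ε u F) : IsParallel e Θ := by
  refine ⟨fun i p v w ↦ ?_, _, h.isPotential⟩
  have h3 (v : TangentSpace (𝓡 3) p) := h.theta p (e.sharp i p) v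
  simp only [h.mfderiv_sharp] at h3
  rw [h.d_form]
  refine (h.normal.d_eq h.contDiff_u F i (φ p) _ _).trans ?_
  rw [thetaForm, h3, h3, h.coframe, h.coframe]
  rfl

/-- With f = -(u + ∫F) the rescaled form exp(f) e_u is exp(-∫F) dx, and its dual field is exp(∫F)
∂_x. Integral curves are solutions on the line, lifted to lines parallel to the x-axis. -/
theorem isCompleteField (h : HasNormalForm e Θ φ ε u F)
    (hF : IsCompleteField 𝓘(ℝ, ℝ) (lineField F)) :
    IsCompleteField (𝓡 3) ((e.rescale _ h.isPotential.1).sharp 0) := by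
  intro p
  obtain ⟨c, hc0, hc⟩ := hF (φ p 0)
  let κ : ℝ → R3 := fun t ↦ φ p + (c t - φ p 0) • ex
  have hκ0 (t : ℝ) : κ t 0 = c t := by simp [κ, ex_apply_zero]
  have hκ (t : ℝ) : HasMFDerivAt 𝓘(ℝ, ℝ) (𝓡 3) κ t ((1 : ℝ →L[ℝ] ℝ).smulRight
      (Real.exp (∫ s in (0 : ℝ)..(c t), F s) • ex)) := by
    have h1 : HasFDerivAt c ((1 : ℝ →L[ℝ] ℝ).smulRight
        (Real.exp (∫ s in (0 : ℝ)..(c t), F s))) t := (hc t).hasFDerivAt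
    have h2 : HasDerivAt c (Real.exp (∫ s in (0 : ℝ)..(c t), F s)) t := by
      have := h1.hasDerivAt
      simpa using this
    have h3 := (((h2.sub_const (φ p 0)).smul_const ex).const_add (φ p)).hasFDerivAt.hasMFDerivAt
    refine h3.congr_mfderiv ?_
    refine ContinuousLinearMap.ext fun r ↦ ?_
    rfl
  refine ⟨fun t ↦ φ.symm (κ t), by simp [κ, hc0], fun t ↦ ?_⟩
  have h4 := ((φ.symm.contMDiff.mdifferentiableAt (x := κ t) (by simp)).hasMFDerivAt).comp_curve
    (hκ t)
  refine h4.congr_mfderiv ?_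
  congr 1
  refine Coframe.eq_sharp _ fun i ↦ ?_
  change (if i = 0 then Real.exp (potential u F (φ (φ.symm (κ t)))) else 1)
    * e.form i (φ.symm (κ t)) (mfderiv (𝓡 3) (𝓡 3) φ.symm (κ t) _) = _
  have h5 := h.form_mfderiv_symm i (κ t) (Real.exp (∫ s in (0 : ℝ)..(c t), F s) • ex)
  rw [h5, map_smul, φ.apply_symm_apply]
  by_cases hi : i = 0
  · subst hi
    rw [if_pos rfl, if_pos rfl, h.normal.isAdapted.form_zero, ex_apply_zero, potential, hκ0,
      smul_eq_mul, mul_one, ← Real.exp_add, ← Real.exp_add,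
      ← Real.exp_zero]
    congr 1
    ring
  · rw [h.normal.isAdapted.form_ex i hi, if_neg hi, if_neg hi]
    simp

end HasNormalForm

end CauchyPair

/-! ### The Leibniz rule, functions along orbits, and diffeomorphisms from a left inverse -/

namespace CauchyPair

open Set Filter

variable {M : Type*} [TopologicalSpace M] [ChartedSpace R3 M]

/-- The differential of a function, as a one-form. -/
def differential (g : M → ℝ) : OneForm M := fun p ↦ mfderiv (𝓡 3) 𝓘(ℝ, ℝ) g p

theorem curl_smul {G : R3 → ℝ} {θ : R3 → R3 →L[ℝ] ℝ} {y : R3} (hG : DifferentiableAt ℝ G y)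
    (hθ : DifferentiableAt ℝ θ y) (v w : R3) :
    curl (fun y ↦ G y • θ y) y v w
      = G y * curl θ y v w + (fderiv ℝ G y v * θ y w - fderiv ℝ G y w * θ y v) := by
  have h : HasFDerivAt (fun y ↦ G y • θ y) _ y := hG.hasFDerivAt.smul hθ.hasFDerivAt
  rw [curl, h.fderiv, curl]
  simp only [add_apply, smul_apply, smul_eq_mul, ContinuousLinearMap.smulRight_apply]
  ring

section Leibniz

variable [IsManifold (𝓡 3) ∞ M]

theorem OneForm.inChart_apply_mfderiv (η : OneForm M) (p : M) (v : TangentSpace (𝓡 3) p) :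
    η.inChart p (extChartAt (𝓡 3) p p) (mfderiv (𝓡 3) (𝓡 3) (extChartAt (𝓡 3) p) p v)
      = η p v := by
  have h := mfderivWithin_extChartAt_symm_comp_mfderiv_extChartAt (I := 𝓡 3)
    (mem_extChartAt_target (I := 𝓡 3) p)
  simp only [modelWithCornersSelf_coe, range_id, mfderivWithin_univ] at h
  have h5 : ∀ (p' : M) (_ : p' = p) (_ : (mfderiv (𝓡 3) (𝓡 3) (extChartAt (𝓡 3) p).symm
      (extChartAt (𝓡 3) p p)).comp (mfderiv (𝓡 3) (𝓡 3) (extChartAt (𝓡 3) p) p')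
        = ContinuousLinearMap.id ℝ R3),
      η p' (mfderiv (𝓡 3) (𝓡 3) (extChartAt (𝓡 3) p).symm (extChartAt (𝓡 3) p p)
        (mfderiv (𝓡 3) (𝓡 3) (extChartAt (𝓡 3) p) p v)) = η p v := by
    rintro p' rfl h
    exact congrArg (η p') (DFunLike.congr_fun h v)
  exact h5 _ (extChartAt_to_inv p) h

theorem OneForm.Smooth.differentiableAt_inChart {η : OneForm M} (hη : η.Smooth) (p : M) :
    DifferentiableAt ℝ (η.inChart p) (extChartAt (𝓡 3) p p) := by
  have hopen : IsOpen (extChartAt (𝓡 3) p).target := isOpen_extChartAt_target p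
  exact ((hη.contDiffOn_pullback hopen (contMDiffOn_extChartAt_symm p)).contDiffAt
    (hopen.mem_nhds (mem_extChartAt_target p))).differentiableAt (by simp)

/-- The Leibniz rule for the exterior derivative. -/
theorem OneForm.Smooth.d_smul {η : OneForm M} (hη : η.Smooth) {g : M → ℝ}
    (hg : ContMDiff (𝓡 3) 𝓘(ℝ, ℝ) ∞ g) (p : M) (v w : TangentSpace (𝓡 3) p) :
    OneForm.d (fun p ↦ g p • η p) p v w = g p * η.d p v w
      + (differential g p v * η p w - differential g p w * η p v) := by
  set χ := extChartAt (𝓡 3) p with hχ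
  have hopen : IsOpen χ.target := isOpen_extChartAt_target p
  have hmem : χ p ∈ χ.target := mem_extChartAt_target p
  have hθ := hη.differentiableAt_inChart p
  have hsymm : ContMDiffAt (𝓡 3) (𝓡 3) ∞ χ.symm (χ p) :=
    (contMDiffOn_extChartAt_symm p).contMDiffAt (hopen.mem_nhds hmem)
  have hGm : ContMDiffAt (𝓡 3) 𝓘(ℝ, ℝ) ∞ (fun y ↦ g (χ.symm y)) (χ p) :=
    (hg.contMDiffAt (x := χ.symm (χ p))).comp (χ p) hsymm
  have hG : DifferentiableAt ℝ (fun y ↦ g (χ.symm y)) (χ p) :=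
    (ContMDiffAt.contDiffAt hGm).differentiableAt (by simp)
  have hG0 : g (χ.symm (χ p)) = g p := by rw [extChartAt_to_inv]
  have hdG (v : TangentSpace (𝓡 3) p) : fderiv ℝ (fun y ↦ g (χ.symm y)) (χ p)
      (mfderiv (𝓡 3) (𝓡 3) χ p v : R3) = differential g p v := by
    have h1 : g =ᶠ[𝓝 p] (fun y ↦ g (χ.symm y)) ∘ χ := by
      filter_upwards [extChartAt_source_mem_nhds (I := 𝓡 3) p] with q hq
      exact congrArg g (χ.left_inv hq).symm
    have h2 := mfderiv_comp p (hGm.mdifferentiableAt (by simp))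
      ((contMDiffAt_extChartAt (I := 𝓡 3) (n := ∞) (x := p)).mdifferentiableAt (by simp))
    rw [← mfderiv_eq_fderiv]
    exact (DFunLike.congr_fun h2 v).symm.trans (DFunLike.congr_fun h1.mfderiv_eq v).symm
  have hd : DifferentiableAt ℝ (OneForm.inChart (fun p ↦ g p • η p) p) (χ p) := hG.smul hθ
  have h1 := extDeriv_ofSubsingleton hd
    (mfderiv (𝓡 3) (𝓡 3) χ p v) (mfderiv (𝓡 3) (𝓡 3) χ p w)
  have h2 := extDeriv_ofSubsingleton hθ
    (mfderiv (𝓡 3) (𝓡 3) χ p v) (mfderiv (𝓡 3) (𝓡 3) χ p w)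
  have h3 : η.d p v w = _ := h2
  refine h1.trans ((curl_smul hG hθ _ _).trans ?_)
  rw [h3, ← hdG, ← hdG, ← η.inChart_apply_mfderiv p v, ← η.inChart_apply_mfderiv p w, hG0]

end Leibniz

section Curves

/-- A function whose derivative along an integral curve is constant is affine along the curve. -/
theorem eq_add_mul_of_isMIntegralCurve {g : M → ℝ} (hg : ContMDiff (𝓡 3) 𝓘(ℝ, ℝ) ∞ g)
    {V : (p : M) → TangentSpace (𝓡 3) p} {γ : ℝ → M} (hγ : IsMIntegralCurve γ V) {c : ℝ}
    (h : ∀ t, mfderiv (𝓡 3) 𝓘(ℝ, ℝ) g (γ t) (V (γ t)) = c) (t : ℝ) :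
    g (γ t) = g (γ 0) + c * t := by
  have hd (t : ℝ) : HasDerivAt (fun s ↦ g (γ s) - c * s) 0 t := by
    have h1 := ((hg.mdifferentiableAt (x := γ t) (by simp)).hasMFDerivAt).comp_curve (hγ t)
    rw [h t] at h1
    have h2 : HasFDerivAt (fun s ↦ g (γ s)) ((1 : ℝ →L[ℝ] ℝ).smulRight c) t := h1.hasFDerivAt
    have h3 : HasDerivAt (fun s ↦ g (γ s)) c t := by simpa using h2.hasDerivAt
    have h4 : HasDerivAt (fun s ↦ c * s) c t := by simpa using (hasDerivAt_id t).const_mul c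
    have h5 := h3.sub h4
    rwa [sub_self] at h5
  have := is_const_of_deriv_eq_zero (fun t ↦ (hd t).differentiableAt) (fun t ↦ (hd t).deriv) t 0
  linarith

/-- A differential sends velocities to velocities, so a pullback is evaluated on an orbit's velocity
once the image curve is known, without computing the differential of `r`. -/
theorem OneForm.pullback_apply_of_comp_eq {N : Type*} [TopologicalSpace N] [ChartedSpace R3 N]
    (η : OneForm M) {r : N → M} {c : ℝ → N} {c' : ℝ → M} {t : ℝ}
    {v : TangentSpace (𝓡 3) (c t)} {w : TangentSpace (𝓡 3) (c' t)}
    (hr : MDifferentiableAt (𝓡 3) (𝓡 3) r (c t))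
    (hc : HasMFDerivAt 𝓘(ℝ, ℝ) (𝓡 3) c t ((1 : ℝ →L[ℝ] ℝ).smulRight v))
    (hc' : HasMFDerivAt 𝓘(ℝ, ℝ) (𝓡 3) c' t ((1 : ℝ →L[ℝ] ℝ).smulRight w))
    (h : (fun s ↦ r (c s)) = c') : η.pullback r (c t) v = η (c' t) w := by
  subst h
  have h1 := hasMFDerivAt_unique (hr.hasMFDerivAt.comp_curve hc) hc'
  have h2 := DFunLike.congr_fun h1 (1 : ℝ)
  have h3 : mfderiv (𝓡 3) (𝓡 3) r (c t) v = w := by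
    have e1 (x : R3) : ((1 : ℝ →L[ℝ] ℝ).smulRight x) (1 : ℝ) = x := by simp
    exact (e1 _).symm.trans (h2.trans (e1 _))
  exact congrArg (η (r (c t))) h3

theorem exists_smooth_flow [IsManifold (𝓡 3) ∞ M] [T2Space M]
    {V : (p : M) → TangentSpace (𝓡 3) p}
    (hV : ContMDiff (𝓡 3) (𝓡 3).tangent ∞ (fun p ↦ (⟨p, V p⟩ : TangentBundle (𝓡 3) M)))
    (hc : IsCompleteField (𝓡 3) V) :
    ∃ φ : M → ℝ → M, (∀ p, φ p 0 = p) ∧ (∀ p, IsMIntegralCurve (φ p) V) ∧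
      (∀ p s t, φ (φ p s) t = φ p (t + s)) ∧
      ContMDiff ((𝓡 3).prod 𝓘(ℝ, ℝ)) (𝓡 3) ∞ (fun z : M × ℝ ↦ φ z.1 z.2) := by
  choose φ h0 hφ using hc
  exact ⟨φ, h0, hφ, integralFlow_add (hV.of_le one_le_infty) h0 hφ,
    contMDiff_integralFlow hV h0 hφ⟩

end Curves

section Inverse

variable [IsManifold (𝓡 3) ∞ M]

/-- A smooth map from `ℝ³` with a smooth left inverse has open range. -/
theorem isOpen_range_of_leftInverse {Φ : M → R3} {Ψ : R3 → M}
    (hΦ : ContMDiff (𝓡 3) (𝓡 3) ∞ Φ) (hΨ : ContMDiff (𝓡 3) (𝓡 3) ∞ Ψ)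
    (h : ∀ q, Φ (Ψ q) = q) : IsOpen (range Ψ) := by
  rw [isOpen_iff_mem_nhds]
  rintro _ ⟨q, rfl⟩
  set χ := extChartAt (𝓡 3) (Ψ q) with hχ
  have hΨc : ContinuousAt Ψ q := hΨ.continuous.continuousAt
  have hGm : ContMDiffAt (𝓡 3) (𝓡 3) ∞ (fun z ↦ χ (Ψ z)) q :=
    (contMDiffAt_extChartAt (I := 𝓡 3) (x := Ψ q)).comp q hΨ.contMDiffAt
  have hG : ContDiffAt ℝ ∞ (fun z ↦ χ (Ψ z)) q := hGm.contDiffAt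
  have hmem : χ (Ψ q) ∈ χ.target := mem_extChartAt_target (Ψ q)
  have hsymm : ContMDiffAt (𝓡 3) (𝓡 3) ∞ χ.symm (χ (Ψ q)) :=
    (contMDiffOn_extChartAt_symm (Ψ q)).contMDiffAt
      ((isOpen_extChartAt_target (Ψ q)).mem_nhds hmem)
  have hsrc : ∀ᶠ z in 𝓝 q, Ψ z ∈ χ.source := hΨc (extChartAt_source_mem_nhds (Ψ q))
  have hKm : ContMDiffAt (𝓡 3) (𝓡 3) ∞ (fun y ↦ Φ (χ.symm y)) (χ (Ψ q)) :=
    (hΦ.contMDiffAt (x := χ.symm (χ (Ψ q)))).comp (χ (Ψ q)) hsymm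
  have hK : ContDiffAt ℝ ∞ (fun y ↦ Φ (χ.symm y)) (χ (Ψ q)) := hKm.contDiffAt
  have hid : (fun z ↦ Φ (χ.symm (χ (Ψ z)))) =ᶠ[𝓝 q] id := by
    filter_upwards [hsrc] with z hz
    rw [χ.left_inv hz, h]
    rfl
  have hGd : HasFDerivAt (fun z ↦ χ (Ψ z)) (fderiv ℝ (fun z ↦ χ (Ψ z)) q) q :=
    (hG.differentiableAt (by simp)).hasFDerivAt
  have hcomp := ((hK.differentiableAt (by simp)).hasFDerivAt).comp q hGd
  have h1 : (fderiv ℝ (fun y ↦ Φ (χ.symm y)) (χ (Ψ q))).comp (fderiv ℝ (fun z ↦ χ (Ψ z)) q)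
      = ContinuousLinearMap.id ℝ R3 := by
    rw [← hcomp.fderiv]
    exact (hid.fderiv_eq (𝕜 := ℝ)).trans fderiv_id
  have hinj : Function.Injective (fderiv ℝ (fun z ↦ χ (Ψ z)) q) := by
    intro v w hvw
    have := congrArg (fderiv ℝ (fun y ↦ Φ (χ.symm y)) (χ (Ψ q))) hvw
    exact (DFunLike.congr_fun h1 v).symm.trans (this.trans (DFunLike.congr_fun h1 w))
  -- The left inverse makes the derivative injective; equal dimensions make it surjective, so the
  -- map is open at `q`.
  have hsurj : (fderiv ℝ (fun z ↦ χ (Ψ z)) q).range = ⊤ := by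
    rw [LinearMap.range_eq_top]
    exact LinearMap.injective_iff_surjective.mp hinj
  have hmap := (hG.hasStrictFDerivAt (by simp)).map_nhds_eq_of_surj hsurj
  have hsymmmap : map χ.symm (𝓝 (χ (Ψ q))) = 𝓝 (Ψ q) := by
    have := map_extChartAt_symm_nhdsWithin_range (I := 𝓡 3) (Ψ q)
    rwa [modelWithCornersSelf_coe, range_id, nhdsWithin_univ] at this
  rw [← hsymmmap, ← hmap, Filter.map_map, mem_map]
  filter_upwards [hsrc] with z hz
  exact ⟨z, (χ.left_inv hz).symm⟩

/-- A smooth map from `ℝ³` to a connected Hausdorff manifold with a smooth left inverse is a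
diffeomorphism. -/
theorem exists_diffeomorph_of_leftInverse [T2Space M] [ConnectedSpace M] {Φ : M → R3} {Ψ : R3 → M}
    (hΦ : ContMDiff (𝓡 3) (𝓡 3) ∞ Φ) (hΨ : ContMDiff (𝓡 3) (𝓡 3) ∞ Ψ)
    (h : ∀ q, Φ (Ψ q) = q) :
    ∃ φ : M ≃ₘ^∞⟮𝓡 3, 𝓡 3⟯ R3, ⇑φ = Φ ∧ ⇑φ.symm = Ψ := by
  -- As a fixed-point set in a Hausdorff space the range is closed; being also open, it is
  -- everything by connectedness.
  have hr : range Ψ = {p | Ψ (Φ p) = p} := by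
    ext p
    constructor
    · rintro ⟨q, rfl⟩
      exact congrArg Ψ (h q)
    · intro hp
      exact ⟨Φ p, hp⟩
  have hclosed : IsClosed (range Ψ) := by
    rw [hr]
    exact isClosed_eq (hΨ.continuous.comp hΦ.continuous) continuous_id
  have huniv : range Ψ = univ := IsClopen.eq_univ
    ⟨hclosed, isOpen_range_of_leftInverse hΦ hΨ h⟩ (range_nonempty Ψ)
  have hinv : ∀ p, Ψ (Φ p) = p := fun p ↦ by
    have : p ∈ range Ψ := huniv ▸ mem_univ p
    rwa [hr] at this
  exact ⟨⟨⟨Φ, Ψ, hinv, h⟩, hΦ, hΨ⟩, rfl, rfl⟩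

end Inverse

end CauchyPair

/-! ### Global adapted coordinates and the normal form -/

namespace CauchyPair

open Set Filter

variable {M : Type*} [TopologicalSpace M] [ChartedSpace R3 M] [IsManifold (𝓡 3) ∞ M]

section Coordinates

variable {e : Coframe M} {Θ : ShapeOperator M} {f : M → ℝ}

theorem Coframe.rescale_form (e : Coframe M) (hf : ContMDiff (𝓡 3) 𝓘(ℝ, ℝ) ∞ f) (i : Fin 3)
    (p : M) (v : TangentSpace (𝓡 3) p) :
    (e.rescale f hf).form i p v = (if i = 0 then Real.exp (f p) else 1) * e.form i p v :=
  rfl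

/-- For a solution of the differential system with potential `f`, the form `exp(f) e_u` is
closed. -/
theorem d_rescale_form_zero (hd : ∀ (p : M) (v w : TangentSpace (𝓡 3) p), (e.form 0).d p v w
      = thetaForm e Θ 0 p v * e.form 0 p w - thetaForm e Θ 0 p w * e.form 0 p v)
    (hf : IsPotential e Θ f) (p : M) (v w : TangentSpace (𝓡 3) p) :
    ((e.rescale f hf.1).form 0).d p v w = 0 := by
  have hg : ContMDiff (𝓡 3) 𝓘(ℝ, ℝ) ∞ (fun p ↦ Real.exp (f p)) :=
    Real.contDiff_exp.comp_contMDiff hf.1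
  have h1 : (e.rescale f hf.1).form 0 = fun p ↦ Real.exp (f p) • e.form 0 p := by
    funext p
    exact ContinuousLinearMap.ext fun v ↦ rfl
  have h2 (v : TangentSpace (𝓡 3) p) : differential (fun p ↦ Real.exp (f p)) p v
      = -(Real.exp (f p) * thetaForm e Θ 0 p v) := by
    have h3 : HasMFDerivAt 𝓘(ℝ, ℝ) 𝓘(ℝ, ℝ) Real.exp (f p)
        ((1 : ℝ →L[ℝ] ℝ).smulRight (Real.exp (f p))) :=
      (hasDerivAt_iff_hasFDerivAt.mp (Real.hasDerivAt_exp (f p))).hasMFDerivAt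
    have h4 := h3.comp p (hf.1.mdifferentiableAt (x := p) (by simp)).hasMFDerivAt
    have h5 : differential (fun p ↦ Real.exp (f p)) p v
        = differential f p v * Real.exp (f p) := DFunLike.congr_fun h4.mfderiv v
    have h6 : thetaForm e Θ 0 p v = -differential f p v := hf.2 p v
    rw [h5, h6]
    ring
  rw [h1, (e.smooth 0).d_smul hg, h2, h2, hd]
  ring

/-- A complete solution of the differential system on a simply connected manifold admits global
coordinates `(x, y, z)` with `exp(f) e_u = dx` for which `e_l` and `e_n` have no
`dx`-component. -/
theorem exists_adapted_coordinates [T2Space M] [ConnectedSpace M] [SimplyConnectedSpace M]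
    (hd : ∀ (i : Fin 3) (p : M) (v w : TangentSpace (𝓡 3) p), (e.form i).d p v w
      = thetaForm e Θ i p v * e.form 0 p w - thetaForm e Θ i p w * e.form 0 p v)
    (hf : IsPotential e Θ f) (he : e.IsComplete)
    (hX : IsCompleteField (𝓡 3) ((e.rescale f hf.1).sharp 0)) :
    ∃ φ : M ≃ₘ^∞⟮𝓡 3, 𝓡 3⟯ R3,
      (∀ p (v : TangentSpace (𝓡 3) p),
        (mfderiv (𝓡 3) (𝓡 3) φ p v : R3).ofLp 0 = Real.exp (f p) * e.form 0 p v) ∧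
      ∀ i : Fin 3, i ≠ 0 → ∀ q, ((e.form i).pullback φ.symm).coeff q ex = 0 := by
  set e' := e.rescale f hf.1 with he'
  obtain ⟨x, hxs, hx⟩ := ((e'.smooth 0).locallyExact_pullback (f := id) contMDiff_id
    (fun p v w ↦ d_rescale_form_zero (hd 0) hf p _ _)).exists_primitive
  have hx' (p : M) (v : TangentSpace (𝓡 3) p) :
      e'.form 0 p v = mfderiv (𝓡 3) 𝓘(ℝ, ℝ) x p v := by
    rw [← hx, OneForm.pullback, mfderiv_id]
    rfl
  obtain ⟨φX, hX0, hXi, hXadd, hXs⟩ := exists_smooth_flow (e'.contMDiff_sharp 0) hX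
  have hxX (p : M) (t : ℝ) : x (φX p t) = x p + t := by
    have := eq_add_mul_of_isMIntegralCurve hxs (hXi p) (c := 1)
      (fun t ↦ by rw [← hx', e'.form_sharp, if_pos rfl]) t
    rwa [hX0, one_mul] at this
  -- the projection onto the slice `x = 0` along the flow
  let r : M → M := fun p ↦ φX p (-x p)
  have hr : ContMDiff (𝓡 3) (𝓡 3) ∞ r := hXs.comp (contMDiff_id.prodMk hxs.neg)
  have hxr (p : M) : x (r p) = 0 := by simp [r, hxX]
  have hr0 (p : M) (hp : x p = 0) : r p = p := by simp [r, hp, hX0]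
  have hrX (p : M) (t : ℝ) : r (φX p t) = r p := by
    simp only [r, hxX, hXadd]
    congr 1
    ring
  have hdr (p : M) (v : TangentSpace (𝓡 3) p) :
      e.form 0 (r p) (mfderiv (𝓡 3) (𝓡 3) r p v) = 0 := by
    have h1 := mfderiv_comp p (hxs.mdifferentiableAt (x := r p) (by simp))
      (hr.mdifferentiableAt (x := p) (by simp))
    have h2 : x ∘ r = fun _ ↦ 0 := funext hxr
    rw [h2, mfderiv_const] at h1
    have h3 := hx' (r p) (mfderiv (𝓡 3) (𝓡 3) r p v)
    rw [he', Coframe.rescale_form, if_pos rfl] at h3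
    have h4 : Real.exp (f (r p)) * e.form 0 (r p) (mfderiv (𝓡 3) (𝓡 3) r p v) = 0 :=
      h3.trans (DFunLike.congr_fun h1 v).symm
    exact (mul_eq_zero.mp h4).resolve_left (Real.exp_ne_zero _)
  -- the coordinates `y` and `z`
  have hprim (i : Fin 3) := ((e.smooth i).locallyExact_pullback hr (fun p v w ↦ by
    rw [hd, hdr, hdr, mul_zero, mul_zero, sub_zero])).exists_primitive
  choose g hgs hg using hprim
  have hgX (i : Fin 3) (p : M) (t : ℝ) : g i (φX p t) = g i p := by
    have := eq_add_mul_of_isMIntegralCurve (hgs i) (hXi p) (c := 0) (fun t ↦ by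
      rw [← hg]
      have hconst : HasMFDerivAt 𝓘(ℝ, ℝ) (𝓡 3) (fun _ : ℝ ↦ r p) t
          ((1 : ℝ →L[ℝ] ℝ).smulRight (0 : TangentSpace (𝓡 3) (r p))) := by
        refine (hasMFDerivAt_const (r p) t).congr_mfderiv ?_
        exact ContinuousLinearMap.ext fun s ↦ (@smul_zero ℝ R3 _ _ s).symm
      rw [(e.form i).pullback_apply_of_comp_eq (hr.mdifferentiableAt (by simp)) (hXi p t) hconst
        (funext (hrX p)), map_zero]) t
    rwa [hX0, zero_mul, add_zero] at this
  have hflow (j : Fin 3) := exists_smooth_flow (e.contMDiff_sharp j) (he.isCompleteField_sharp j)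
  choose φV hV0 hVi hVadd hVs using hflow
  have hxV (j : Fin 3) (hj : j ≠ 0) (p : M) (t : ℝ) : x (φV j p t) = x p := by
    have := eq_add_mul_of_isMIntegralCurve hxs (hVi j p) (c := 0) (fun t ↦ by
      rw [← hx', he', Coframe.rescale_form, e.form_sharp, if_neg hj.symm, mul_zero]) t
    rwa [hV0, zero_mul, add_zero] at this
  -- An orbit of e_j♯ starting in the slice x = 0 stays there, and r is the identity on it; so
  -- r^*e_i takes the value δ_ij on its velocity.
  have hgV (i j : Fin 3) (hj : j ≠ 0) (p : M) (hp : x p = 0) (t : ℝ) :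
      g i (φV j p t) = g i p + (if i = j then 1 else 0) * t := by
    have := eq_add_mul_of_isMIntegralCurve (hgs i) (hVi j p) (c := if i = j then 1 else 0)
      (fun t ↦ by
        rw [← hg, (e.form i).pullback_apply_of_comp_eq (hr.mdifferentiableAt (by simp)) (hVi j p t)
          (hVi j p t) (funext fun s ↦ hr0 _ ((hxV j hj p s).trans hp)), e.form_sharp]) t
    rwa [hV0] at this
  -- the diffeomorphism
  obtain ⟨p₁⟩ : Nonempty M := inferInstance
  set p₀ := r p₁ with hp₀
  have hxp₀ : x p₀ = 0 := hxr p₁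
  let Φ : M → R3 := fun p ↦ WithLp.toLp 2 ![x p, g 1 p - g 1 p₀, g 2 p - g 2 p₀]
  let B : R3 → M := fun q ↦ φV 1 (φV 2 p₀ (q 2)) (q 1)
  -- The flows need not be known to commute: tracking x and the primitives along each flow already
  -- shows that `Φ` is a left inverse.
  let Ψ : R3 → M := fun q ↦ φX (B q) (q 0)
  have hcoord (i : Fin 3) : ContMDiff (𝓡 3) 𝓘(ℝ, ℝ) ∞ (fun q : R3 ↦ q i) :=
    (EuclideanSpace.proj (𝕜 := ℝ) i).contDiff.contMDiff
  have hB : ContMDiff (𝓡 3) (𝓡 3) ∞ B :=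
    (hVs 1).comp (((hVs 2).comp (contMDiff_const.prodMk (hcoord 2))).prodMk (hcoord 1))
  have hΨ : ContMDiff (𝓡 3) (𝓡 3) ∞ Ψ := hXs.comp (hB.prodMk (hcoord 0))
  have hΦ : ContMDiff (𝓡 3) (𝓡 3) ∞ Φ := by
    have h1 : ContMDiff (𝓡 3) 𝓘(ℝ, Fin 3 → ℝ) ∞
        (fun p ↦ ![x p, g 1 p - g 1 p₀, g 2 p - g 2 p₀]) := by
      rw [contMDiff_pi_space]
      intro i
      fin_cases i
      · exact hxs
      · exact (hgs 1).sub contMDiff_const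
      · exact (hgs 2).sub contMDiff_const
    exact (EuclideanSpace.equiv (Fin 3) ℝ).symm.contDiff.contMDiff.comp h1
  have hx2 (q : R3) : x (φV 2 p₀ (q 2)) = 0 := by rw [hxV 2 (by decide), hxp₀]
  have hΦΨ (q : R3) : Φ (Ψ q) = q := by
    have hxB : x (B q) = 0 := by rw [hxV 1 (by decide), hx2]
    have e0 : x (Ψ q) = q 0 := by rw [hxX, hxB, zero_add]
    have e1 : g 1 (Ψ q) = g 1 p₀ + q 1 := by
      rw [hgX, hgV 1 1 (by decide) _ (hx2 q), hgV 1 2 (by decide) _ hxp₀]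
      simp
    have e2 : g 2 (Ψ q) = g 2 p₀ + q 2 := by
      rw [hgX, hgV 2 1 (by decide) _ (hx2 q), hgV 2 2 (by decide) _ hxp₀]
      simp
    ext i
    fin_cases i
    · exact e0
    · change g 1 (Ψ q) - g 1 p₀ = q 1
      rw [e1]
      ring
    · change g 2 (Ψ q) - g 2 p₀ = q 2
      rw [e2]
      ring
  obtain ⟨φ, hφ, hφs⟩ := exists_diffeomorph_of_leftInverse hΦ hΨ hΦΨ
  refine ⟨φ, fun p v ↦ ?_, fun i hi q ↦ ?_⟩
  · have h1 := mfderiv_comp p ((hcoord 0).mdifferentiableAt (x := Φ p) (by simp))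
      (hΦ.mdifferentiableAt (x := p) (by simp))
    have h2 : (fun q : R3 ↦ q 0) ∘ Φ = x := rfl
    have h3 : (mfderiv (𝓡 3) 𝓘(ℝ, ℝ) (fun q : R3 ↦ q 0) (Φ p) : R3 →L[ℝ] ℝ)
        = EuclideanSpace.proj (𝕜 := ℝ) (0 : Fin 3) := by
      rw [mfderiv_eq_fderiv]
      exact (EuclideanSpace.proj (𝕜 := ℝ) (0 : Fin 3)).fderiv
    rw [h2] at h1
    have h4 := (hx' p v).trans (DFunLike.congr_fun h1 v)
    rw [he', Coframe.rescale_form, if_pos rfl] at h4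
    rw [h4, hφ]
    exact (DFunLike.congr_fun h3 (mfderiv (𝓡 3) (𝓡 3) Φ p v : R3)).symm
  · rw [hφs]
    let κ : ℝ → R3 := fun t ↦ q + (t - q 0) • ex
    have hκ : HasMFDerivAt 𝓘(ℝ, ℝ) (𝓡 3) κ (q 0) ((1 : ℝ →L[ℝ] ℝ).smulRight ex) := by
      have h1 : HasDerivAt κ ex (q 0) := by
        have h2 := (((hasDerivAt_id (q 0)).sub_const (q 0)).smul_const ex).const_add q
        rwa [one_smul] at h2
      exact (hasDerivAt_iff_hasFDerivAt.mp h1).hasMFDerivAt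
    have hκq : κ (q 0) = q := by simp [κ]
    -- Lines parallel to the x-axis map to orbits of ê_u♯, which e_l and e_n annihilate.
    have hcomp : (fun s ↦ Ψ (κ s)) = φX (B q) := by
      funext s
      simp [Ψ, B, κ, ex]
    have h1 := (e.form i).pullback_apply_of_comp_eq (hΨ.mdifferentiableAt (by simp)) hκ
      (hXi (B q) (q 0)) hcomp
    have h2 : e.form i (φX (B q) (q 0)) (e'.sharp 0 (φX (B q) (q 0))) = 0 := by
      have h3 := e'.form_sharp i 0 (φX (B q) (q 0))
      rw [he', Coframe.rescale_form, if_neg hi, if_neg hi, one_mul] at h3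
      exact h3
    have h4 : ((e.form i).pullback Ψ).coeff (κ (q 0)) ex = 0 := h1.trans h2
    rwa [hκq] at h4

/-- A solution of the differential system is in normal form in adapted coordinates. -/
theorem exists_hasNormalForm
    (hd : ∀ (i : Fin 3) (p : M) (v w : TangentSpace (𝓡 3) p), (e.form i).d p v w
      = thetaForm e Θ i p v * e.form 0 p w - thetaForm e Θ i p w * e.form 0 p v)
    (hf : IsPotential e Θ f) (φ : M ≃ₘ^∞⟮𝓡 3, 𝓡 3⟯ R3)
    (h0 : ∀ p (v : TangentSpace (𝓡 3) p),
      (mfderiv (𝓡 3) (𝓡 3) φ p v : R3).ofLp 0 = Real.exp (f p) * e.form 0 p v)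
    (hex : ∀ i : Fin 3, i ≠ 0 → ∀ q, ((e.form i).pullback φ.symm).coeff q ex = 0) :
    ∃ (ε : Coframe R3) (u : R3 → ℝ), HasNormalForm e Θ φ ε u (fun _ ↦ 0) := by
  have hsymm : ContMDiff (𝓡 3) (𝓡 3) ∞ φ.symm := φ.symm.contMDiff
  let D : ∀ q : R3, R3 →L[ℝ] TangentSpace (𝓡 3) (φ.symm q) :=
    fun q ↦ mfderiv (𝓡 3) (𝓡 3) φ.symm q
  have hDinv (q v : R3) : (mfderiv (𝓡 3) (𝓡 3) φ (φ.symm q) (D q v) : R3) = v :=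
    mfderiv_apply_mfderiv_symm φ q v
  have hinvD (q : R3) (v : TangentSpace (𝓡 3) (φ.symm q)) :
      D q (mfderiv (𝓡 3) (𝓡 3) φ (φ.symm q) v : R3) = v := mfderiv_symm_apply_mfderiv φ q v
  let ε : Coframe R3 :=
    { form := fun i ↦ (e.form i).pullback φ.symm
      smooth := fun i ↦ OneForm.smooth_of_contDiff (contDiffOn_univ.mp
        ((e.smooth i).contDiffOn_pullback isOpen_univ hsymm.contMDiffOn))
      bijective := fun q ↦ by
        have hD : Function.Bijective (D q) := by
          refine ⟨fun v w hvw ↦ ?_, fun v ↦ ⟨_, hinvD q v⟩⟩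
          rw [← hDinv q v, hvw, hDinv]
        exact (e.bijective (φ.symm q)).comp hD }
  have hε (i : Fin 3) (q v : R3) : (ε.form i).coeff q v = e.form i (φ.symm q) (D q v) := rfl
  -- The choice is forced by dx = exp(f) e_u, that is, e_u = exp(-f) dx.
  let u : R3 → ℝ := fun q ↦ -f (φ.symm q)
  have hfu : ContMDiff (𝓡 3) 𝓘(ℝ, ℝ) ∞ u := (hf.1.comp hsymm).neg
  have hu : ContDiff ℝ ∞ u := hfu.contDiff
  have hA : IsAdapted ε u := by
    refine ⟨fun q v ↦ ?_, hex⟩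
    have h1 := h0 (φ.symm q) (D q v)
    rw [hDinv] at h1
    rw [hε, h1, ← mul_assoc, ← Real.exp_add]
    simp [u]
  have hframe (i : Fin 3) (q : R3) : D q (ε.frame i q) = e.sharp i (φ.symm q) :=
    e.eq_sharp fun j ↦ (hε j q (ε.frame i q)).symm.trans (ε.coeff_sharp j i q)
  let T : R3 → R3 →L[ℝ] R3 →L[ℝ] ℝ := fun q ↦
    let S : R3 →L[ℝ] R3 →L[ℝ] ℝ := Θ.tensor (φ.symm q)
    let D' : R3 →L[ℝ] R3 := D q
    S.bilinearComp D' D'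
  have hT (q v w : R3) : T q v w = Θ.tensor (φ.symm q) (D q v) (D q w) := rfl
  have hT0 (q w : R3) : T q (ε.frame 0 q) w = fderiv ℝ u q w := by
    have h1 : T q (ε.frame 0 q) w = -(mfderiv (𝓡 3) 𝓘(ℝ, ℝ) f (φ.symm q) (D q w) : ℝ) := by
      rw [hT, hframe]
      exact hf.2 (φ.symm q) (D q w)
    have h2 : HasMFDerivAt (𝓡 3) 𝓘(ℝ, ℝ) (fun q ↦ f (φ.symm q)) q
        ((mfderiv (𝓡 3) 𝓘(ℝ, ℝ) f (φ.symm q)).comp (D q)) :=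
      (hf.1.mdifferentiableAt (by simp)).hasMFDerivAt.comp q
        (hsymm.mdifferentiableAt (by simp)).hasMFDerivAt
    have h3 : HasFDerivAt u _ q := h2.hasFDerivAt.neg
    rw [h1, h3.fderiv]
    rfl
  have hTd (i : Fin 3) (q v w : R3) : (ε.form i).d q v w
      = T q (ε.frame i q) v * (ε.form 0).coeff q w
        - T q (ε.frame i q) w * (ε.form 0).coeff q v := by
    have h1 := (e.smooth i).curl_pullback isOpen_univ (hsymm.contMDiffOn (s := univ))
      (mem_univ q) v w
    rw [OneForm.d_eq_curl (ε.smooth i)]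
    refine h1.trans ((hd i (φ.symm q) (D q v) (D q w)).trans ?_)
    rw [hT, hT, hframe, hε, hε]
    rfl
  obtain ⟨hN, hTN⟩ := hA.isNormalCoframe hu T (fun q v w ↦ Θ.symm _ _ _) hT0 hTd
  refine ⟨ε, u, hu, contDiff_const, fun i p v ↦ ?_, hN, fun p v w ↦ ?_⟩
  · obtain ⟨q, rfl⟩ : ∃ q, φ.symm q = p := ⟨φ p, φ.symm_apply_apply p⟩
    have h1 := hε i q (mfderiv (𝓡 3) (𝓡 3) φ (φ.symm q) v)
    rw [hinvD] at h1
    rw [← h1, φ.apply_symm_apply]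
    rfl
  · obtain ⟨q, rfl⟩ : ∃ q, φ.symm q = p := ⟨φ p, φ.symm_apply_apply p⟩
    have h1 := (hT q (mfderiv (𝓡 3) (𝓡 3) φ (φ.symm q) v)
      (mfderiv (𝓡 3) (𝓡 3) φ (φ.symm q) w)).symm.trans (hTN q _ _)
    rw [hinvD, hinvD] at h1
    rw [h1, φ.apply_symm_apply]

end Coordinates

theorem isCompleteField_lineField_zero : IsCompleteField 𝓘(ℝ, ℝ) (lineField fun _ ↦ 0) := by
  intro p
  refine ⟨fun t ↦ t + p, zero_add p, fun t ↦ ?_⟩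
  have h1 : HasFDerivAt (fun t : ℝ ↦ t + p) ((1 : ℝ →L[ℝ] ℝ).smulRight (1 : ℝ)) t :=
    hasDerivAt_iff_hasFDerivAt.mp ((hasDerivAt_id t).add_const p)
  have h2 : (lineField (fun _ ↦ 0) (t + p) : ℝ) = 1 := by
    change Real.exp _ = 1
    simp
  refine h1.hasMFDerivAt.congr_mfderiv ?_
  exact congrArg ((1 : ℝ →L[ℝ] ℝ).smulRight) h2.symm

end CauchyPair
end

theorem mainTheorem2 {M : Type*} [TopologicalSpace M] [ChartedSpace CauchyPair.R3 M]
    [IsManifold (𝓡 3) ∞ M] [T2Space M] [SecondCountableTopology M]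
    [ConnectedSpace M] [SimplyConnectedSpace M]
    (e : CauchyPair.Coframe M) (Θ : CauchyPair.ShapeOperator M) :
    ((CauchyPair.IsParallel e Θ ∧ CauchyPair.IsFullyComplete e Θ) ↔
      ∃ (φ : M ≃ₘ^∞⟮𝓡 3, 𝓡 3⟯ CauchyPair.R3) (ε : CauchyPair.Coframe CauchyPair.R3)
        (u : CauchyPair.R3 → ℝ) (F : ℝ → ℝ),
        CauchyPair.HasNormalForm e Θ φ ε u F ∧
          e.IsComplete ∧ CauchyPair.IsCompleteField 𝓘(ℝ, ℝ) (CauchyPair.lineField F)) ∧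
    ∀ (φ : M ≃ₘ^∞⟮𝓡 3, 𝓡 3⟯ CauchyPair.R3) (ε : CauchyPair.Coframe CauchyPair.R3)
      (u : CauchyPair.R3 → ℝ) (F : ℝ → ℝ),
      CauchyPair.HasNormalForm e Θ φ ε u F → CauchyPair.IsParallel e Θ := by
  refine ⟨⟨?_, ?_⟩, fun φ ε u F h ↦ h.isParallel⟩
  · rintro ⟨⟨hd, -⟩, he, f, hf, hX⟩
    obtain ⟨φ, h0, hex⟩ := CauchyPair.exists_adapted_coordinates hd hf he hX
    obtain ⟨ε, u, h⟩ := CauchyPair.exists_hasNormalForm hd hf φ h0 hex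
    -- Taking x as a primitive of exp(f) e_u normalizes F to 0, so the line field is ∂_x.
    exact ⟨φ, ε, u, _, h, he, CauchyPair.isCompleteField_lineField_zero⟩
  · rintro ⟨φ, ε, u, F, h, he, hF⟩
    exact ⟨h.isParallel, he, _, h.isPotential, h.isCompleteField hF⟩
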